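/- Let $n\ge 1$ and $\delta>0$. For $\beta<n+2$ let $m^{\delta,\beta}(\nu)=c^{\delta,\beta}\int_{B_\delta(0)}\frac{\cos(\nu\cdot z)-1}{\|z\|^\beta}\,dz$, where $c^{\delta,\beta}=\frac{2(n+2-\beta)\Gamma(n/2+1)}{\pi^{n/2}\delta^{n+2-\beta}}$, be the Fourier multiplier of the nonlocal Laplace operator $L^{\delta,\beta}u(x)=c^{\delta,\beta}\int_{B_\delta(0)}\frac{u(x+z)-u(x)}{\|z\|^\beta}\,dz$; for $n+2\le\beta<n+4$ the multiplier is given by the extension $m^{\delta,\beta}(\nu)=-\|\nu\|^2\,{}_2F_3\left(1,\tfrac{n+2-\beta}{2};2,\tfrac{n+2}{2},\tfrac{n+4-\beta}{2};-\tfrac14\|\nu\|^2\delta^2\right)$. For a periodic distribution $T=\sum_{k\in\mathbb Z^n}\hat T_k e^{ik\cdot x}$ on the torus $\mathbf T^n=\mathbb R^n/2\pi\mathbb Z^n$ put $L^{\delta,\beta}T=\sum_k m^{\delta,\beta}(k)\hat T_k e^{ik\cdot x}$, and for $q\in\mathbb R$ let $H^q(\mathbf T^n)$ be the space of periodic distributions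 $T$ with $\|T\|_{H^q}^2=\sum_k(1+\|k\|^2)^q|\hat T_k|^2<\infty$. Let $s_1,s_2\in\mathbb R$, $f\in H^{s_1}(\mathbf T^n)$ and $g\in H^{s_2}(\mathbf T^n)$. For $\beta<n+4$ consider the nonlocal wave equation $U''(t)=L^{\delta,\beta}U(t)$ $(t>0)$, $U(0)=f$, $U'(0)=g$, and the classical wave equation $U''(t)=\Delta U(t)$ $(t>0)$, $U(0)=f$, $U'(0)=g$, where a solution is a map $U:[0,\infty)\to H^q(\mathbf T^n)$, for some $q\in\mathbb R$, that is twice differentiable with respect to the norm of $H^q(\mathbf T^n)$ and satisfies these equations. Then the classical equation and, for every $\beta<n+4$, the nonlocal equation have a solution. Moreover, let $U^0$ be a solution of the classical equation and, for every $\beta<n+4$, let $U^{\delta,\beta}$ be a solution of the nonlocal equation. Then $U^0(t)\in H^{s}(\mathbf T^n)$ with $s=\min\{s_1,s_2+1\}$ and $U^{\delta,\beta}(t)\in H^{s'}(\mathbf T^n)$ with $s'=\min\{s_1,s_2+\max\{0,\frac{\beta-n}{2}\}\}$, for all $t\ge0$ and $\beta<n+4$; and for any $t\ge 0$ and any $\varepsilon\in(0,2)$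 with $\varepsilon<n/2$, \[ \lim_{\beta\to n+2}U^{\delta,\beta}(t)=U^0(t)\quad\text{in } H^{s_0}(\mathbf T^n),\qquad s_0=\min\left\{s_1,\,s_2+\frac{2-\varepsilon}{2}\right\}. \] -/

import Mathlib

open Filter Topology
open scoped ContDiff

noncomputable section

namespace NonlocalWave

/-- `ℝⁿ` with its Euclidean norm. -/
abbrev E (n : ℕ) : Type := EuclideanSpace ℝ (Fin n)

/-- The lattice point `k ∈ ℤⁿ`, seen in `ℝⁿ`. -/
def latticePoint {n : ℕ} (k : Fin n → ℤ) : E n := WithLp.toLp 2 (fun i => (k i : ℝ))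

/-! ### Periodic distributions -/

/-- Test functions on the torus: smooth functions `ℝⁿ → ℂ` that are `2π`-periodic in every
coordinate. -/
def TestFunction (n : ℕ) : Submodule ℂ (E n → ℂ) where
  carrier := {φ | ContDiff ℝ ∞ φ ∧
    ∀ (i : Fin n) (x : E n), φ (x + EuclideanSpace.single i (2 * Real.pi)) = φ x}
  zero_mem' := ⟨contDiff_const, fun _ _ => rfl⟩
  add_mem' := fun ha hb => ⟨ha.1.add hb.1, fun i x => by simp [ha.2 i x, hb.2 i x]⟩
  smul_mem' := fun c _ ha => ⟨contDiff_const.smul ha.1, fun i x => by simp [ha.2 i x]⟩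

/-- Periodic distributions on the torus: the linear functionals on the test functions that are
continuous for the topology of uniform convergence of all derivatives, that is, bounded by a
constant times the maximum of the suprema of finitely many derivatives. -/
def PeriodicDistribution (n : ℕ) : Submodule ℂ (TestFunction n →ₗ[ℂ] ℂ) where
  carrier := {T | ∃ (C : ℝ) (N : ℕ), ∀ (φ : TestFunction n) (M : ℝ),
    (∀ j ≤ N, ∀ x : E n, ‖iteratedFDeriv ℝ j (φ : E n → ℂ) x‖ ≤ M) → ‖T φ‖ ≤ C * M}
  zero_mem' := ⟨0, 0, fun _ _ _ => by simp⟩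
  add_mem' := by
    rintro S T ⟨C, N, hS⟩ ⟨D, K, hT⟩
    refine ⟨C + D, max N K, fun φ M h => ?_⟩
    have h1 := hS φ M fun j hj => h j (hj.trans (le_max_left _ _))
    have h2 := hT φ M fun j hj => h j (hj.trans (le_max_right _ _))
    calc ‖(S + T) φ‖ ≤ ‖S φ‖ + ‖T φ‖ := norm_add_le _ _
      _ ≤ (C + D) * M := by linarith
  smul_mem' := by
    rintro c T ⟨C, N, hT⟩
    refine ⟨‖c‖ * C, N, fun φ M h => ?_⟩
    have h1 := hT φ M h
    have h2 : ‖(c • T) φ‖ = ‖c‖ * ‖T φ‖ := by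
      rw [LinearMap.smul_apply, smul_eq_mul, norm_mul]
    calc ‖(c • T) φ‖ = ‖c‖ * ‖T φ‖ := h2
      _ ≤ ‖c‖ * (C * M) := by gcongr
      _ = ‖c‖ * C * M := by ring

/-- The test function `x ↦ exp (i k · x)`. -/
def character {n : ℕ} (k : Fin n → ℤ) : TestFunction n :=
  ⟨fun x => Complex.exp (Complex.I * ((inner ℝ (latticePoint k) x : ℝ) : ℂ)), by
    refine ⟨?_, fun i x => ?_⟩
    · exact (contDiff_const.mul (Complex.ofRealCLM.contDiff.comp
        (contDiff_const.inner ℝ contDiff_id))).cexp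
    · have h : (inner ℝ (latticePoint k) (EuclideanSpace.single i (2 * Real.pi)) : ℝ)
          = (k i : ℝ) * (2 * Real.pi) := by
        simp [EuclideanSpace.inner_single_right, latticePoint, mul_comm]
      change Complex.exp (Complex.I * ((inner ℝ (latticePoint k)
        (x + EuclideanSpace.single i (2 * Real.pi)) : ℝ) : ℂ)) =
          Complex.exp (Complex.I * ((inner ℝ (latticePoint k) x : ℝ) : ℂ))
      rw [inner_add_right, h, Complex.exp_eq_exp_iff_exists_int]
      refine ⟨k i, ?_⟩
      push_cast
      ring⟩

/-- The Fourier coefficient `(2π)⁻ⁿ ⟨T, exp (- i k · x)⟩` of a periodic distribution, normalised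
so that `T = ∑ₖ T̂ₖ exp (i k · x)`. -/
def fourierCoefficient {n : ℕ} (T : PeriodicDistribution n) (k : Fin n → ℤ) : ℂ :=
  ((2 * Real.pi : ℂ) ^ n)⁻¹ * (T : TestFunction n →ₗ[ℂ] ℂ) (character (-k))

/-! ### Sobolev spaces on the torus -/

/-- `T` belongs to the Sobolev space `H^q` of the torus. -/
def MemH {n : ℕ} (q : ℝ) (T : PeriodicDistribution n) : Prop :=
  Summable fun k : Fin n → ℤ => (1 + ‖latticePoint k‖ ^ 2) ^ q * ‖fourierCoefficient T k‖ ^ 2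

/-- The norm of `H^q`; meaningful for `T` in `H^q`. -/
def normH {n : ℕ} (q : ℝ) (T : PeriodicDistribution n) : ℝ :=
  Real.sqrt (∑' k : Fin n → ℤ, (1 + ‖latticePoint k‖ ^ 2) ^ q * ‖fourierCoefficient T k‖ ^ 2)

/-- `F` converges to `T` in `H^q` along the filter `l`: the limit is in `H^q`, the values of `F`
are eventually in `H^q`, and the norm of the difference tends to zero. -/
def TendstoH {n : ℕ} {ι : Type*} (q : ℝ) (F : ι → PeriodicDistribution n) (l : Filter ι)
    (T : PeriodicDistribution n) : Prop :=
  MemH q T ∧ (∀ᶠ i in l, MemH q (F i)) ∧ Tendsto (fun i => normH q (F i - T)) l (𝓝 0)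

/-- `V` is the derivative at time `t ≥ 0`, with respect to the norm of `H^q`, of the map
`U : [0, ∞) → H^q` (only the values of `U` at nonnegative times matter). -/
def HasDerivH {n : ℕ} (q : ℝ) (U : ℝ → PeriodicDistribution n) (V : PeriodicDistribution n)
    (t : ℝ) : Prop :=
  TendstoH q (fun h : ℝ => ((h : ℂ)⁻¹) • (U (t + h) - U t)) (𝓝[{h | h ≠ 0 ∧ 0 ≤ t + h}] 0) V

/-! ### The nonlocal Laplace operator -/

/-- The hypergeometric function `₂F₃ (a₁, a₂; b₁, b₂, b₃; z)`. -/
def hypergeometric2F3 (a₁ a₂ b₁ b₂ b₃ z : ℝ) : ℝ :=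
  ∑' j : ℕ, ((ascPochhammer ℝ j).eval a₁ * (ascPochhammer ℝ j).eval a₂) /
    ((ascPochhammer ℝ j).eval b₁ * (ascPochhammer ℝ j).eval b₂ * (ascPochhammer ℝ j).eval b₃) *
    (z ^ j / (j.factorial : ℝ))

/-- The scaling constant `c^{δ,β}` in dimension `n`. -/
def scalingConstant (n : ℕ) (δ β : ℝ) : ℝ :=
  2 * ((n : ℝ) + 2 - β) * Real.Gamma ((n : ℝ) / 2 + 1) /
    (Real.pi ^ ((n : ℝ) / 2) * δ ^ ((n : ℝ) + 2 - β))

open Classical in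
/-- The Fourier multiplier `m^{δ,β}`: for `β < n + 2` that of the integral operator
`u ↦ c^{δ,β} ∫_{B_δ(0)} (u (x + z) - u x) / ‖z‖^β dz`, and for `β ≥ n + 2` (away from the
poles `n + 4, n + 6, …`) its hypergeometric extension. -/
def multiplier {n : ℕ} (δ β : ℝ) (ν : E n) : ℝ :=
  if β < (n : ℝ) + 2 then
    scalingConstant n δ β *
      ∫ z in Metric.ball (0 : E n) δ, (Real.cos (inner ℝ ν z) - 1) / ‖z‖ ^ β
  else
    -‖ν‖ ^ 2 * hypergeometric2F3 1 (((n : ℝ) + 2 - β) / 2) 2 (((n : ℝ) + 2) / 2)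
      (((n : ℝ) + 4 - β) / 2) (-(1 / 4) * ‖ν‖ ^ 2 * δ ^ 2)

/-- `S = L^{δ,β} T`, where `L^{δ,β} T = ∑ₖ m^{δ,β}(k) T̂ₖ exp (i k · x)`. -/
def IsNonlocalLaplacian {n : ℕ} (δ β : ℝ) (T S : PeriodicDistribution n) : Prop :=
  ∀ k : Fin n → ℤ,
    fourierCoefficient S k = ((multiplier δ β (latticePoint k) : ℝ) : ℂ) * fourierCoefficient T k

/-- The Laplacian of a test function. -/
def testLaplacian {n : ℕ} (φ : TestFunction n) : TestFunction n :=
  ⟨Laplacian.laplacian (φ : E n → ℂ), by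
    rw [InnerProductSpace.laplacian_eq_iteratedFDeriv_stdOrthonormalBasis]
    refine ⟨?_, fun i x => ?_⟩
    · refine ContDiff.sum fun j _ => ?_
      exact (ContinuousMultilinearMap.apply ℝ (fun _ : Fin 2 => E n) ℂ _).contDiff.comp
        (φ.2.1.iteratedFDeriv_right (m := ∞) (i := 2) (le_of_eq rfl))
    · have h : (fun y => (φ : E n → ℂ) (y + EuclideanSpace.single i (2 * Real.pi))) = φ :=
        funext fun y => φ.2.2 i y
      have h2 := iteratedFDeriv_comp_add_right (𝕜 := ℝ) (f := (φ : E n → ℂ)) 2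
        (EuclideanSpace.single i (2 * Real.pi)) x
      rw [h] at h2
      simp only [h2]⟩

/-- `S = Δ T` in the sense of distributions. -/
def IsLaplacian {n : ℕ} (T S : PeriodicDistribution n) : Prop :=
  ∀ φ : TestFunction n, (S : TestFunction n →ₗ[ℂ] ℂ) φ =
    (T : TestFunction n →ₗ[ℂ] ℂ) (testLaplacian φ)

/-! ### Wave equations -/

/-- `U : [0, ∞) → H^q`, for some real `q`, is twice differentiable and solves `U'' = A U` for
`t > 0`, `U 0 = f`, `U' 0 = g`, where the operator `A` is given by its graph. -/
def IsWaveSolution {n : ℕ} (A : PeriodicDistribution n → PeriodicDistribution n → Prop)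
    (f g : PeriodicDistribution n) (U : ℝ → PeriodicDistribution n) : Prop :=
  ∃ (q : ℝ) (V W : ℝ → PeriodicDistribution n),
    (∀ t, 0 ≤ t → MemH q (U t)) ∧
    (∀ t, 0 ≤ t → HasDerivH q U (V t) t) ∧
    (∀ t, 0 ≤ t → HasDerivH q V (W t) t) ∧
    (∀ t, 0 < t → A (U t) (W t)) ∧
    U 0 = f ∧ V 0 = g

/-- `U` solves the nonlocal wave equation `U'' = L^{δ,β} U`, `U 0 = f`, `U' 0 = g`. -/
def IsNonlocalWaveSolution {n : ℕ} (δ β : ℝ) (f g : PeriodicDistribution n)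
    (U : ℝ → PeriodicDistribution n) : Prop :=
  IsWaveSolution (IsNonlocalLaplacian δ β) f g U

/-- `U` solves the classical wave equation `U'' = Δ U`, `U 0 = f`, `U' 0 = g`. -/
def IsClassicalWaveSolution {n : ℕ} (f g : PeriodicDistribution n)
    (U : ℝ → PeriodicDistribution n) : Prop :=
  IsWaveSolution IsLaplacian f g U

end NonlocalWave

end

open Filter Topology
open scoped ContDiff

noncomputable section

namespace NonlocalWave

/-! Both equations are diagonal in Fourier coefficients: with `μ = -m(k)` (or `‖k‖²` classically),
each coefficient solves `u'' = -μ u`. If `μ ≥ 0`, then `u(t) = cos(√μ t) f̂ₖ + (sin(√μ t)/√μ) ĝₖ`,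
with `t` in place of the quotient when `μ = 0`. This gives uniqueness on the Fourier side
(`eq_waveSol`). Existence (`exists_isWaveSolution`) requires only that `μ` be nonnegative and
polynomially bounded, because every polynomially bounded family is the Fourier coefficient family of
a distribution (`exists_fourierCoefficient_eq`).

The cosine factor preserves regularity. The sine factor gains `σ` derivatives once `μₖ ≥ c ‖k‖^(2σ)`
for `k ≠ 0` (`waveSin_sq_le`). Regularity is thus a lower bound on `-m`. Convergence follows by
dominated convergence from pointwise convergence of the multipliers and a lower bound `c ‖k‖^(2-ε)`
uniform for `β` near `n + 2`.

The multiplier estimates depend on the side of `n + 2`. Below it, `1 - cos` is compared with a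
quadratic whose ball integral is computed exactly by symmetry; restricting to a ball of radius about
`1/‖ν‖` gives the lower bound (`le_neg_multiplier`). At `n + 2` the multiplier is `-‖ν‖²`. Above it,
put `a = (n + 2 - β)/2 ∈ (-1, 0)`, `c = n/2`, and write `-m = ‖ν‖² G(‖ν‖² δ²/4)`. Then `(x^a G)' = a
x^(a-1) H`, where `x H = c (1 - F)` and `F(x) = ₀F₁(; c; -x)`. An energy argument for the Bessel
equation gives `|F| ≤ 1`, hence `0 ≤ H ≤ 1`. So `x^a (G - 1)` increases and `x^a G` decreases, which
pins the growth of `-m` to `‖ν‖^(β-n)`. -/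

/-- The weight `1 + ‖k‖²` of a lattice point. -/
def weight {n : ℕ} (k : Fin n → ℤ) : ℝ := 1 + ‖latticePoint k‖ ^ 2

lemma one_le_weight {n : ℕ} (k : Fin n → ℤ) : 1 ≤ weight k := by
  unfold weight; nlinarith [sq_nonneg ‖latticePoint k‖]

lemma weight_pos {n : ℕ} (k : Fin n → ℤ) : 0 < weight k := one_pos.trans_le (one_le_weight k)

lemma norm_latticePoint_sq {n : ℕ} (k : Fin n → ℤ) : ‖latticePoint k‖ ^ 2 = ∑ i, (k i : ℝ) ^ 2 := by
  simp [EuclideanSpace.norm_sq_eq, latticePoint]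

lemma latticePoint_neg {n : ℕ} (k : Fin n → ℤ) : latticePoint (-k) = -latticePoint k := by
  ext i; simp [latticePoint]

lemma one_le_norm_latticePoint {n : ℕ} {k : Fin n → ℤ} (hk : k ≠ 0) : 1 ≤ ‖latticePoint k‖ := by
  obtain ⟨i, hi⟩ := Function.ne_iff.1 hk
  rw [← one_le_sq_iff₀ (norm_nonneg _), norm_latticePoint_sq]
  have h1 : (1 : ℝ) ≤ (k i : ℝ) ^ 2 := by
    have : (1 : ℤ) ≤ (k i) ^ 2 := by
      have : k i ≠ 0 := hi
      have := sq_nonneg (k i); have : k i ^ 2 ≠ 0 := by positivity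
      omega
    exact_mod_cast this
  exact h1.trans (Finset.single_le_sum (f := fun i => (k i : ℝ) ^ 2)
    (fun j _ => sq_nonneg _) (Finset.mem_univ i))

lemma latticePoint_zero {n : ℕ} : latticePoint (0 : Fin n → ℤ) = 0 := by
  ext i; simp [latticePoint]

lemma weight_le_two_mul {n : ℕ} {k : Fin n → ℤ} (hk : k ≠ 0) :
    weight k ≤ 2 * ‖latticePoint k‖ ^ 2 := by
  unfold weight; nlinarith [one_le_norm_latticePoint hk]

/-! ### Summability over the lattice -/

lemma summable_int_inv_one_add_sq : Summable fun m : ℤ => (1 + (m : ℝ) ^ 2)⁻¹ := by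
  have h : Summable fun m : ℤ => 1 / (m : ℝ) ^ 2 := Real.summable_one_div_int_pow.2 one_lt_two
  refine Summable.of_norm_bounded_eventually (g := fun m : ℤ => 1 / (m : ℝ) ^ 2) h ?_
  refine (Set.finite_singleton (0 : ℤ)).subset fun m hm => ?_
  by_contra h0
  refine hm ?_
  change ‖(1 + (m : ℝ) ^ 2)⁻¹‖ ≤ 1 / (m : ℝ) ^ 2
  have h1 : (0 : ℝ) < (m : ℝ) ^ 2 := by
    have : (m : ℝ) ≠ 0 := by exact_mod_cast h0
    positivity
  rw [Real.norm_of_nonneg (by positivity), one_div]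
  gcongr
  linarith

/-- Any finite set of lattice points lies in a box, over which the sum of products factors into a
product of sums. -/
lemma summable_pi_prod {n : ℕ} {f : ℤ → ℝ} (h0 : ∀ m, 0 ≤ f m) (hf : Summable f) :
    Summable fun k : Fin n → ℤ => ∏ i, f (k i) := by
  classical
  refine summable_of_sum_le (c := ∏ _i : Fin n, ∑' m, f m)
    (fun k => Finset.prod_nonneg fun i _ => h0 _) fun s => ?_
  have hs : s ⊆ Fintype.piFinset (fun i : Fin n => s.image fun k => k i) := fun k hk =>
    Fintype.mem_piFinset.2 fun i => Finset.mem_image_of_mem (fun k : Fin n → ℤ => k i) hk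
  calc ∑ k ∈ s, ∏ i, f (k i)
      ≤ ∑ k ∈ Fintype.piFinset (fun i : Fin n => s.image fun k => k i), ∏ i, f (k i) :=
        Finset.sum_le_sum_of_subset_of_nonneg hs fun k _ _ => Finset.prod_nonneg fun i _ => h0 _
    _ = ∏ i : Fin n, ∑ m ∈ s.image (fun k => k i), f m := by rw [Finset.prod_univ_sum]
    _ ≤ _ := Finset.prod_le_prod (fun i _ => Finset.sum_nonneg fun m _ => h0 m)
        fun i _ => hf.sum_le_tsum _ fun m _ => h0 m

/-- Each factor `1 + kᵢ²` is at most the weight, so the `n`-th power of the weight dominates their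
product. -/
lemma summable_inv_weight_pow (n : ℕ) : Summable fun k : Fin n → ℤ => (weight k ^ n)⁻¹ := by
  refine Summable.of_nonneg_of_le (fun k => by have := weight_pos k; positivity) (fun k => ?_)
    (summable_pi_prod (n := n) (fun m => by positivity) summable_int_inv_one_add_sq)
  rw [Finset.prod_inv_distrib]
  have h : ∏ i, (1 + (k i : ℝ) ^ 2) ≤ ∏ _i : Fin n, weight k := by
    refine Finset.prod_le_prod (fun i _ => by positivity) fun i _ => ?_
    rw [weight, norm_latticePoint_sq]
    gcongr
    exact Finset.single_le_sum (f := fun i => (k i : ℝ) ^ 2)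
      (fun j _ => sq_nonneg _) (Finset.mem_univ i)
  have h2 : 0 < ∏ i, (1 + (k i : ℝ) ^ 2) := Finset.prod_pos fun i _ => by positivity
  rw [Finset.prod_const, Finset.card_univ, Fintype.card_fin] at h
  gcongr

/-! ### Fourier coefficients -/

lemma fourierCoefficient_sub {n : ℕ} (S T : PeriodicDistribution n) (k : Fin n → ℤ) :
    fourierCoefficient (S - T) k = fourierCoefficient S k - fourierCoefficient T k := by
  simp [fourierCoefficient, mul_sub]

lemma fourierCoefficient_smul {n : ℕ} (c : ℂ) (T : PeriodicDistribution n) (k : Fin n → ℤ) :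
    fourierCoefficient (c • T) k = c * fourierCoefficient T k := by
  simp [fourierCoefficient, mul_left_comm]

/-! ### The Laplacian of a periodic distribution -/

lemma testLaplacian_apply {n : ℕ} (φ : TestFunction n) (x : E n) :
    (testLaplacian φ : E n → ℂ) x =
      ∑ i, fderiv ℝ (fderiv ℝ (φ : E n → ℂ)) x (EuclideanSpace.single i 1)
        (EuclideanSpace.single i 1) := by
  change Laplacian.laplacian (φ : E n → ℂ) x = _
  rw [InnerProductSpace.laplacian_eq_iteratedFDeriv_orthonormalBasis _
    (EuclideanSpace.basisFun (Fin n) ℝ)]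
  simp [iteratedFDeriv_two_apply]

lemma testLaplacian_add {n : ℕ} (φ ψ : TestFunction n) :
    testLaplacian (φ + ψ) = testLaplacian φ + testLaplacian ψ := by
  ext x
  exact ContDiffAt.laplacian_add ((contDiff_infty.1 φ.2.1 2).contDiffAt)
    ((contDiff_infty.1 ψ.2.1 2).contDiffAt)

lemma testLaplacian_smul {n : ℕ} (c : ℂ) (φ : TestFunction n) :
    testLaplacian (c • φ) = c • testLaplacian φ := by
  ext x
  exact InnerProductSpace.laplacian_smul c ((contDiff_infty.1 φ.2.1 2).contDiffAt)

-- Continuity of `Δ` on test functions, at the cost of two derivatives; this is what makes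
-- `distLaplacian` a distribution.
set_option maxSynthPendingDepth 5 in
lemma norm_iteratedFDeriv_testLaplacian_le {n : ℕ} (φ : TestFunction n) (j : ℕ) (x : E n) :
    ‖iteratedFDeriv ℝ j (testLaplacian φ : E n → ℂ) x‖ ≤
      n * ‖iteratedFDeriv ℝ (j + 2) (φ : E n → ℂ) x‖ := by
  have hφ : ContDiff ℝ ∞ (fderiv ℝ (fderiv ℝ (φ : E n → ℂ))) :=
    (φ.2.1.fderiv_right (m := ∞) (by simp)).fderiv_right (by simp)
  let A (i : Fin n) : (E n →L[ℝ] E n →L[ℝ] ℂ) →L[ℝ] ℂ :=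
    (ContinuousLinearMap.apply ℝ ℂ (EuclideanSpace.single i 1 : E n)).comp
      (ContinuousLinearMap.apply ℝ (E n →L[ℝ] ℂ) (EuclideanSpace.single i 1 : E n))
  have hA (i : Fin n) : ‖A i‖ ≤ 1 := by
    refine ContinuousLinearMap.opNorm_le_bound _ zero_le_one fun B => ?_
    calc ‖B (EuclideanSpace.single i 1) (EuclideanSpace.single i 1)‖
        ≤ ‖B‖ * ‖(EuclideanSpace.single i 1 : E n)‖ * ‖(EuclideanSpace.single i 1 : E n)‖ :=
          B.le_opNorm₂ _ _
      _ = 1 * ‖B‖ := by simp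
  have h1 : (testLaplacian φ : E n → ℂ) =
      fun x => ∑ i, (A i ∘ fderiv ℝ (fderiv ℝ (φ : E n → ℂ))) x :=
    funext fun x => testLaplacian_apply φ x
  rw [h1, iteratedFDeriv_fun_sum_apply fun i _ =>
    (contDiff_infty.1 ((A i).contDiff.comp hφ) j).contDiffAt]
  calc _ ≤ ∑ i : Fin n, ‖iteratedFDeriv ℝ j (A i ∘ fderiv ℝ (fderiv ℝ (φ : E n → ℂ))) x‖ :=
        norm_sum_le _ _
    _ ≤ ∑ _i : Fin n, ‖iteratedFDeriv ℝ (j + 2) (φ : E n → ℂ) x‖ := by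
        refine Finset.sum_le_sum fun i _ => ?_
        rw [(A i).iteratedFDeriv_comp_left (contDiff_infty.1 hφ j).contDiffAt le_rfl]
        refine (ContinuousLinearMap.norm_compContinuousMultilinearMap_le _ _).trans ?_
        rw [norm_iteratedFDeriv_fderiv, norm_iteratedFDeriv_fderiv]
        exact mul_le_of_le_one_left (norm_nonneg _) (hA i)
    _ = _ := by simp

/-- The Laplacian of a periodic distribution. -/
def distLaplacian {n : ℕ} (T : PeriodicDistribution n) : PeriodicDistribution n :=
  ⟨{ toFun := fun φ => (T : TestFunction n →ₗ[ℂ] ℂ) (testLaplacian φ)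
     map_add' := fun φ ψ => by rw [testLaplacian_add, map_add]
     map_smul' := fun c φ => by rw [testLaplacian_smul, map_smul]; rfl }, by
    obtain ⟨C, N, hT⟩ := T.2
    refine ⟨C * n, N + 2, fun φ M h => ?_⟩
    rw [mul_assoc]
    refine hT _ _ fun j hj x => (norm_iteratedFDeriv_testLaplacian_le φ j x).trans ?_
    gcongr
    exact h _ (by omega) x⟩

lemma isLaplacian_distLaplacian {n : ℕ} (T : PeriodicDistribution n) :
    IsLaplacian T (distLaplacian T) := fun _ => rfl

lemma testLaplacian_character {n : ℕ} (k : Fin n → ℤ) :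
    testLaplacian (character k) = ((-‖latticePoint k‖ ^ 2 : ℝ) : ℂ) • character k := by
  ext x
  let L : E n →L[ℝ] ℂ :=
    Complex.I • Complex.ofRealCLM.comp (innerSL ℝ (latticePoint k))
  have h0 : (character k : E n → ℂ) = fun x => Complex.exp (L x) := rfl
  have h1 : fderiv ℝ (character k : E n → ℂ) = fun x => Complex.exp (L x) • L := by
    rw [h0]
    funext y
    exact (L.hasFDerivAt.cexp).fderiv
  have h2 (y : E n) : fderiv ℝ (fun x => Complex.exp (L x) • L) y =
      (Complex.exp (L y) • L).smulRight L :=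
    (L.hasFDerivAt.cexp.smul_const L).fderiv
  have h3 (i : Fin n) : L (EuclideanSpace.single i 1) = Complex.I * (k i : ℂ) := by
    simp [L, EuclideanSpace.inner_single_right, latticePoint]
  rw [testLaplacian_apply, h1, h2]
  change _ = ((-‖latticePoint k‖ ^ 2 : ℝ) : ℂ) * Complex.exp (L x)
  rw [norm_latticePoint_sq]
  simp only [ContinuousLinearMap.smulRight_apply, smul_apply, h3, smul_eq_mul]
  push_cast
  rw [neg_mul, Finset.sum_mul, ← Finset.sum_neg_distrib]
  refine Finset.sum_congr rfl fun i _ => ?_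
  linear_combination (Complex.exp (L x) * (k i : ℂ) ^ 2) * Complex.I_sq

lemma fourierCoefficient_of_isLaplacian {n : ℕ} {T S : PeriodicDistribution n}
    (h : IsLaplacian T S) (k : Fin n → ℤ) :
    fourierCoefficient S k = ((-‖latticePoint k‖ ^ 2 : ℝ) : ℂ) * fourierCoefficient T k := by
  rw [fourierCoefficient, h, testLaplacian_character, map_smul, latticePoint_neg, norm_neg,
    fourierCoefficient, smul_eq_mul]
  ring

/-! ### Periodic distributions with prescribed Fourier coefficients -/

/-- The half-open cube of side `2π`. -/
def cube (n : ℕ) : Set (Fin n → ℝ) := Set.univ.pi fun _ => Set.Ioc 0 (2 * Real.pi)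

lemma integral_exp_int_mul (k : ℤ) :
    ∫ x : ℝ in Set.Ioc 0 (2 * Real.pi), Complex.exp (Complex.I * ((k * x : ℝ) : ℂ)) =
      if k = 0 then (2 * Real.pi : ℂ) else 0 := by
  rw [← intervalIntegral.integral_of_le (by positivity)]
  split_ifs with h
  · simp [h]
  · have hc : Complex.I * (k : ℂ) ≠ 0 := mul_ne_zero Complex.I_ne_zero (by exact_mod_cast h)
    have h1 := integral_exp_mul_complex (a := 0) (b := 2 * Real.pi) hc
    have h2 : Complex.exp (Complex.I * k * ((2 * Real.pi : ℝ) : ℂ)) = 1 := by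
      rw [Complex.exp_eq_one_iff]
      exact ⟨k, by push_cast; ring⟩
    rw [h2] at h1
    simp only [Complex.ofReal_zero, mul_zero, Complex.exp_zero, sub_self, zero_div] at h1
    rw [← h1]
    refine intervalIntegral.integral_congr fun x _ => ?_
    congr 1
    push_cast
    ring

lemma character_toLp {n : ℕ} (k : Fin n → ℤ) (x : Fin n → ℝ) :
    (character k : E n → ℂ) (WithLp.toLp 2 x) =
      ∏ i, Complex.exp (Complex.I * ((k i * x i : ℝ) : ℂ)) := by
  rw [← Complex.exp_sum, ← Finset.mul_sum]
  change Complex.exp (Complex.I * ((inner ℝ (latticePoint k) (WithLp.toLp 2 x) : ℝ) : ℂ)) = _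
  simp [latticePoint, PiLp.inner_apply, mul_comm]

lemma norm_character {n : ℕ} (k : Fin n → ℤ) (x : E n) : ‖(character k : E n → ℂ) x‖ = 1 := by
  change ‖Complex.exp (Complex.I * ((inner ℝ (latticePoint k) x : ℝ) : ℂ))‖ = 1
  rw [mul_comm, Complex.norm_exp_ofReal_mul_I]

lemma integral_cube_character {n : ℕ} (k : Fin n → ℤ) :
    ∫ x in cube n, (character k : E n → ℂ) (WithLp.toLp 2 x) =
      if k = 0 then (2 * Real.pi : ℂ) ^ n else 0 := by
  simp_rw [character_toLp]
  rw [cube, MeasureTheory.volume_pi, MeasureTheory.Measure.restrict_pi_pi,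
    MeasureTheory.integral_fintype_prod_eq_prod (𝕜 := ℂ)
      (fun (i : Fin n) (x : ℝ) => Complex.exp (Complex.I * ((k i * x : ℝ) : ℂ)))]
  simp_rw [integral_exp_int_mul]
  split_ifs with h
  · simp [h]
  · obtain ⟨i, hi⟩ := Function.ne_iff.1 h
    exact Finset.prod_eq_zero (Finset.mem_univ i) (if_neg hi)

lemma integrableOn_cube {n : ℕ} {F : E n → ℂ} (hF : Continuous F) :
    MeasureTheory.IntegrableOn (fun x : Fin n → ℝ => F (WithLp.toLp 2 x)) (cube n) := by
  have h1 : Continuous fun x : Fin n → ℝ => F (WithLp.toLp 2 x) :=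
    hF.comp (PiLp.continuous_toLp 2 _)
  refine (h1.continuousOn.integrableOn_compact
    (isCompact_Icc (a := 0) (b := fun _ : Fin n => 2 * Real.pi))).mono_set fun x hx => ?_
  exact ⟨fun i => (hx i trivial).1.le, fun i => (hx i trivial).2⟩

lemma volume_cube_lt_top (n : ℕ) : MeasureTheory.volume (cube n) < ⊤ := by
  rw [cube, MeasureTheory.volume_pi, MeasureTheory.Measure.pi_pi]
  exact ENNReal.prod_lt_top fun i _ => by rw [Real.volume_Ioc]; exact ENNReal.ofReal_lt_top

/-- The integral of `exp (i k · x) φ x` over the cube. -/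
def characterPairing {n : ℕ} (k : Fin n → ℤ) (φ : TestFunction n) : ℂ :=
  ∫ x in cube n, (character k : E n → ℂ) (WithLp.toLp 2 x) * (φ : E n → ℂ) (WithLp.toLp 2 x)

lemma continuous_character_mul {n : ℕ} (k : Fin n → ℤ) (φ : TestFunction n) :
    Continuous fun x => (character k : E n → ℂ) x * (φ : E n → ℂ) x :=
  (character k).2.1.continuous.mul φ.2.1.continuous

lemma characterPairing_add {n : ℕ} (k : Fin n → ℤ) (φ ψ : TestFunction n) :
    characterPairing k (φ + ψ) = characterPairing k φ + characterPairing k ψ := by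
  rw [characterPairing, characterPairing, characterPairing, ← MeasureTheory.integral_add
    (integrableOn_cube (continuous_character_mul k φ))
    (integrableOn_cube (continuous_character_mul k ψ))]
  simp [mul_add]

lemma characterPairing_smul {n : ℕ} (k : Fin n → ℤ) (c : ℂ) (φ : TestFunction n) :
    characterPairing k (c • φ) = c * characterPairing k φ := by
  rw [characterPairing, characterPairing, ← MeasureTheory.integral_const_mul]
  simp [mul_left_comm]

lemma norm_characterPairing_le {n : ℕ} (k : Fin n → ℤ) (φ : TestFunction n) {M : ℝ}
    (hM : ∀ x, ‖(φ : E n → ℂ) x‖ ≤ M) :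
    ‖characterPairing k φ‖ ≤ M * MeasureTheory.volume.real (cube n) :=
  MeasureTheory.norm_setIntegral_le_of_norm_le_const (volume_cube_lt_top n) fun x _ => by
    rw [norm_mul, norm_character, one_mul]; exact hM _

lemma exists_norm_characterPairing_le {n : ℕ} (φ : TestFunction n) :
    ∃ M, ∀ k : Fin n → ℤ, ‖characterPairing k φ‖ ≤ M := by
  refine ⟨∫ x in cube n, ‖(φ : E n → ℂ) (WithLp.toLp 2 x)‖, fun k => ?_⟩
  refine (MeasureTheory.norm_integral_le_integral_norm _).trans (le_of_eq ?_)
  simp [norm_character]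

lemma characterPairing_character {n : ℕ} (k m : Fin n → ℤ) :
    characterPairing k (character (-m)) = if k = m then (2 * Real.pi : ℂ) ^ n else 0 := by
  have h (x : E n) : (character k : E n → ℂ) x * (character (-m) : E n → ℂ) x =
      (character (k - m) : E n → ℂ) x := by
    change Complex.exp (Complex.I * ((inner ℝ (latticePoint k) x : ℝ) : ℂ)) *
      Complex.exp (Complex.I * ((inner ℝ (latticePoint (-m)) x : ℝ) : ℂ)) =
      Complex.exp (Complex.I * ((inner ℝ (latticePoint (k - m)) x : ℝ) : ℂ))
    have h1 : latticePoint (k - m) = latticePoint k + latticePoint (-m) := by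
      ext i; simp [latticePoint, sub_eq_add_neg]
    rw [← Complex.exp_add, h1, inner_add_left]
    push_cast
    ring_nf
  simp_rw [characterPairing, h, integral_cube_character, sub_eq_zero]

lemma summable_mul_characterPairing {n : ℕ} {a : (Fin n → ℤ) → ℂ} (ha : Summable fun k => ‖a k‖)
    (φ : TestFunction n) : Summable fun k => a k * characterPairing k φ := by
  obtain ⟨M, hM⟩ := exists_norm_characterPairing_le φ
  refine Summable.of_norm_bounded (ha.mul_right M) fun k => ?_
  rw [norm_mul]
  exact mul_le_mul_of_nonneg_left (hM k) (norm_nonneg _)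

/-- The sum of an absolutely convergent Fourier series, as a periodic distribution. -/
def ofSummable {n : ℕ} (a : (Fin n → ℤ) → ℂ) (ha : Summable fun k => ‖a k‖) :
    PeriodicDistribution n :=
  ⟨{ toFun := fun φ => ∑' k, a k * characterPairing k φ
     map_add' := fun φ ψ => by
      simp_rw [characterPairing_add, mul_add]
      exact (summable_mul_characterPairing ha φ).tsum_add (summable_mul_characterPairing ha ψ)
     map_smul' := fun c φ => by
      simp_rw [characterPairing_smul, mul_left_comm _ c]
      exact tsum_mul_left }, by
    refine ⟨(∑' k, ‖a k‖) * MeasureTheory.volume.real (cube n), 0, fun φ M h => ?_⟩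
    have hM (x : E n) : ‖(φ : E n → ℂ) x‖ ≤ M := by simpa using h 0 le_rfl x
    rw [mul_assoc, mul_comm _ M]
    refine tsum_of_norm_bounded (ha.hasSum.mul_right _) fun k => ?_
    rw [norm_mul]
    exact mul_le_mul_of_nonneg_left (norm_characterPairing_le k φ hM) (norm_nonneg _)⟩

lemma fourierCoefficient_ofSummable {n : ℕ} (a : (Fin n → ℤ) → ℂ) (ha : Summable fun k => ‖a k‖)
    (m : Fin n → ℤ) : fourierCoefficient (ofSummable a ha) m = a m := by
  have h : (ofSummable a ha : TestFunction n →ₗ[ℂ] ℂ) (character (-m)) =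
      ∑' k, a k * characterPairing k (character (-m)) := rfl
  rw [fourierCoefficient, h, tsum_eq_single m fun k hk => by
    rw [characterPairing_character, if_neg hk, mul_zero], characterPairing_character, if_pos rfl]
  have : (2 * Real.pi : ℂ) ^ n ≠ 0 := by simp [Real.pi_ne_zero]
  field_simp

/-- Multiplication by the weight is the operator `1 - Δ`, which can be iterated. -/
lemma exists_fourierCoefficient_eq_weight_pow_mul {n : ℕ} (T : PeriodicDistribution n) (p : ℕ) :
    ∃ S : PeriodicDistribution n, ∀ k,
      fourierCoefficient S k = (weight k : ℂ) ^ p * fourierCoefficient T k := by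
  induction p with
  | zero => exact ⟨T, fun k => by simp⟩
  | succ p ih =>
    obtain ⟨S, hS⟩ := ih
    refine ⟨S - distLaplacian S, fun k => ?_⟩
    rw [fourierCoefficient_sub, fourierCoefficient_of_isLaplacian (isLaplacian_distLaplacian S), hS,
      pow_succ, weight]
    push_cast
    ring

/-- Polynomially bounded families are the Fourier coefficients of periodic distributions. -/
theorem exists_fourierCoefficient_eq {n : ℕ} {b : (Fin n → ℤ) → ℂ} {C : ℝ} {p : ℕ}
    (hb : ∀ k, ‖b k‖ ≤ C * weight k ^ p) :
    ∃ T : PeriodicDistribution n, ∀ k, fourierCoefficient T k = b k := by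
  -- The factor `weight ^ p` absorbs the growth of `b`, and the remaining `weight ^ n` makes the
  -- series converge absolutely. Applying `(1 - Δ)^(p + n)` to its sum restores `b`.
  have ha : Summable fun k => ‖((weight k : ℂ) ^ (p + n))⁻¹ * b k‖ := by
    refine Summable.of_nonneg_of_le (fun k => norm_nonneg _) (fun k => ?_)
      ((summable_inv_weight_pow n).mul_left C)
    have hw := weight_pos k
    rw [norm_mul, norm_inv, norm_pow, Complex.norm_real, Real.norm_of_nonneg hw.le]
    calc _ ≤ (weight k ^ (p + n))⁻¹ * (C * weight k ^ p) := by gcongr; exact hb k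
      _ = _ := by rw [pow_add]; field_simp
  obtain ⟨T, hT⟩ := exists_fourierCoefficient_eq_weight_pow_mul (ofSummable _ ha) (p + n)
  refine ⟨T, fun k => ?_⟩
  have hw : (weight k : ℂ) ≠ 0 := by exact_mod_cast (weight_pos k).ne'
  rw [hT, fourierCoefficient_ofSummable]
  field_simp

/-! ### Sobolev spaces -/

lemma memH_iff {n : ℕ} {q : ℝ} {T : PeriodicDistribution n} :
    MemH q T ↔ Summable fun k => weight k ^ q * ‖fourierCoefficient T k‖ ^ 2 := Iff.rfl

lemma weight_rpow_pos {n : ℕ} (k : Fin n → ℤ) (q : ℝ) : 0 < weight k ^ q :=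
  Real.rpow_pos_of_pos (weight_pos k) q

lemma MemH.of_le {n : ℕ} {q C : ℝ} {S : PeriodicDistribution n} {B : (Fin n → ℤ) → ℝ}
    (hB : Summable fun k => weight k ^ q * B k)
    (h : ∀ k, ‖fourierCoefficient S k‖ ^ 2 ≤ C * B k) : MemH q S := by
  refine Summable.of_nonneg_of_le (fun k => mul_nonneg (weight_rpow_pos k q).le (sq_nonneg _))
    (fun k => ?_) (hB.mul_left C)
  calc weight k ^ q * ‖fourierCoefficient S k‖ ^ 2 ≤ weight k ^ q * (C * B k) :=
        mul_le_mul_of_nonneg_left (h k) (weight_rpow_pos k q).le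
    _ = _ := by ring

lemma MemH.mono {n : ℕ} {p q : ℝ} {T : PeriodicDistribution n} (h : MemH q T) (hpq : p ≤ q) :
    MemH p T := by
  refine Summable.of_nonneg_of_le (fun k => mul_nonneg (weight_rpow_pos k p).le (sq_nonneg _))
    (fun k => ?_) h
  exact mul_le_mul_of_nonneg_right (Real.rpow_le_rpow_of_exponent_le (one_le_weight k) hpq)
    (sq_nonneg _)

lemma norm_sub_sq_le (a b : ℂ) : ‖a - b‖ ^ 2 ≤ 2 * (‖a‖ ^ 2 + ‖b‖ ^ 2) := by
  nlinarith [norm_sub_le a b, norm_nonneg (a - b), sq_nonneg (‖a‖ - ‖b‖)]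

lemma norm_add_sq_le (a b : ℂ) : ‖a + b‖ ^ 2 ≤ 2 * (‖a‖ ^ 2 + ‖b‖ ^ 2) := by
  nlinarith [norm_add_le a b, norm_nonneg (a + b), sq_nonneg (‖a‖ - ‖b‖)]

lemma MemH.sub {n : ℕ} {q : ℝ} {S T : PeriodicDistribution n} (hS : MemH q S) (hT : MemH q T) :
    MemH q (S - T) := by
  refine MemH.of_le (C := 2) (B := fun k => ‖fourierCoefficient S k‖ ^ 2 +
    ‖fourierCoefficient T k‖ ^ 2) ?_ fun k => ?_
  · simpa only [mul_add] using (memH_iff.1 hS).add (memH_iff.1 hT)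
  · rw [fourierCoefficient_sub]; exact norm_sub_sq_le _ _

lemma MemH.sq_norm_fourierCoefficient_le {n : ℕ} {q : ℝ} {T : PeriodicDistribution n}
    (hT : MemH q T) (k : Fin n → ℤ) :
    weight k ^ q * ‖fourierCoefficient T k‖ ^ 2 ≤ normH q T ^ 2 := by
  refine le_of_le_of_eq ?_ (Real.sq_sqrt (tsum_nonneg fun k =>
    mul_nonneg (weight_rpow_pos k q).le (sq_nonneg _))).symm
  exact (memH_iff.1 hT).le_tsum k fun j _ => mul_nonneg (weight_rpow_pos j q).le (sq_nonneg _)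

lemma MemH.norm_fourierCoefficient_le {n : ℕ} {q : ℝ} {T : PeriodicDistribution n}
    (hT : MemH q T) (k : Fin n → ℤ) :
    ‖fourierCoefficient T k‖ ≤ weight k ^ (-q / 2) * normH q T := by
  have h := hT.sq_norm_fourierCoefficient_le k
  have h0 : 0 ≤ normH q T := Real.sqrt_nonneg _
  refine abs_le_of_sq_le_sq' ?_ (mul_nonneg (weight_rpow_pos k _).le h0) |>.2
  have h1 : (weight k ^ (-q / 2)) ^ 2 * weight k ^ q = 1 := by
    rw [← Real.rpow_natCast, ← Real.rpow_mul (weight_pos k).le, ← Real.rpow_add (weight_pos k)]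
    norm_num
  calc ‖fourierCoefficient T k‖ ^ 2
      = (weight k ^ (-q / 2)) ^ 2 * (weight k ^ q * ‖fourierCoefficient T k‖ ^ 2) := by
        rw [← mul_assoc, h1, one_mul]
    _ ≤ (weight k ^ (-q / 2)) ^ 2 * normH q T ^ 2 := by gcongr
    _ = _ := by ring

lemma MemH.exists_norm_fourierCoefficient_le {n : ℕ} {q : ℝ} {T : PeriodicDistribution n}
    (hT : MemH q T) :
    ∃ (C : ℝ) (p : ℕ), 0 ≤ C ∧ ∀ k, ‖fourierCoefficient T k‖ ≤ C * weight k ^ p := by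
  refine ⟨normH q T, ⌈-q / 2⌉₊, Real.sqrt_nonneg _, fun k =>
    (hT.norm_fourierCoefficient_le k).trans ?_⟩
  rw [mul_comm, ← Real.rpow_natCast]
  exact mul_le_mul_of_nonneg_left
    (Real.rpow_le_rpow_of_exponent_le (one_le_weight k) (Nat.le_ceil _)) (Real.sqrt_nonneg _)

lemma TendstoH.tendsto_fourierCoefficient {n : ℕ} {ι : Type*} {q : ℝ}
    {F : ι → PeriodicDistribution n} {l : Filter ι} {T : PeriodicDistribution n}
    (h : TendstoH q F l T) (k : Fin n → ℤ) :
    Tendsto (fun i => fourierCoefficient (F i) k) l (𝓝 (fourierCoefficient T k)) := by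
  rw [tendsto_iff_norm_sub_tendsto_zero]
  have h1 := h.2.2.const_mul (weight k ^ (-q / 2))
  rw [mul_zero] at h1
  refine squeeze_zero' (Eventually.of_forall fun i => norm_nonneg _) ?_ h1
  filter_upwards [h.2.1] with i hi
  rw [← fourierCoefficient_sub]
  exact (hi.sub h.1).norm_fourierCoefficient_le k

lemma MemH.of_norm_le {n : ℕ} {q C : ℝ} {S : PeriodicDistribution n} {B : (Fin n → ℤ) → ℝ}
    (hB : Summable fun k => weight k ^ q * B k ^ 2)
    (h : ∀ k, ‖fourierCoefficient S k‖ ≤ C * B k) : MemH q S := by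
  refine MemH.of_le (C := C ^ 2) hB fun k => ?_
  rw [← mul_pow]
  exact pow_le_pow_left₀ (norm_nonneg _) (h k) 2

/-- A family of periodic distributions that converges linearly in every Fourier coefficient, with
constants that are summable against the weight, converges in `H^q`. -/
lemma tendstoH_of_norm_sub_le {n : ℕ} {ι : Type*} {q : ℝ} {F : ι → PeriodicDistribution n}
    {l : Filter ι} {T : PeriodicDistribution n} {r : ι → ℝ} {B : (Fin n → ℤ) → ℝ}
    (hT : MemH q T) (hF : ∀ᶠ i in l, MemH q (F i)) (hr : Tendsto r l (𝓝 0))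
    (hr0 : ∀ᶠ i in l, 0 ≤ r i)
    (hB : Summable fun k => weight k ^ q * B k ^ 2)
    (h : ∀ᶠ i in l, ∀ k, ‖fourierCoefficient (F i) k - fourierCoefficient T k‖ ≤ r i * B k) :
    TendstoH q F l T := by
  refine ⟨hT, hF, ?_⟩
  have h1 := hr.mul_const (Real.sqrt (∑' k, weight k ^ q * B k ^ 2))
  rw [zero_mul] at h1
  refine squeeze_zero' (Eventually.of_forall fun i => Real.sqrt_nonneg _) ?_ h1
  filter_upwards [hF, h, hr0] with i hi hik hri
  rw [← Real.sqrt_sq hri, ← Real.sqrt_mul (sq_nonneg _), ← tsum_mul_left]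
  refine Real.sqrt_le_sqrt (Summable.tsum_le_tsum (fun k => ?_) (hi.sub hT) (hB.mul_left _))
  rw [fourierCoefficient_sub]
  calc weight k ^ q * ‖fourierCoefficient (F i) k - fourierCoefficient T k‖ ^ 2
      ≤ weight k ^ q * (r i * B k) ^ 2 := by
        have := (weight_rpow_pos k q).le
        gcongr
        exact hik k
    _ = _ := by ring

/-- Taking a coefficient is bounded on `H^q`, so the evolution equation descends to scalar ODEs. The
derivative is taken within `[0, ∞)` because it is one-sided at `t = 0`. -/
lemma HasDerivH.hasDerivWithinAt_fourierCoefficient {n : ℕ} {q t : ℝ}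
    {U : ℝ → PeriodicDistribution n} {V : PeriodicDistribution n} (h : HasDerivH q U V t)
    (k : Fin n → ℤ) :
    HasDerivWithinAt (fun s => fourierCoefficient (U s) k) (fourierCoefficient V k)
      (Set.Ici 0) t := by
  rw [hasDerivWithinAt_iff_tendsto_slope]
  have h1 := TendstoH.tendsto_fourierCoefficient h k
  have h2 : Tendsto (fun s : ℝ => s - t) (𝓝[Set.Ici 0 \ {t}] t) (𝓝[{h | h ≠ 0 ∧ 0 ≤ t + h}] 0) := by
    refine tendsto_nhdsWithin_iff.2 ⟨?_, ?_⟩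
    · have : Tendsto (fun s : ℝ => s - t) (𝓝 t) (𝓝 (t - t)) := tendsto_id.sub_const t
      rw [sub_self] at this
      exact this.mono_left nhdsWithin_le_nhds
    · filter_upwards [self_mem_nhdsWithin] with s hs
      exact ⟨sub_ne_zero.2 hs.2, by simpa using hs.1⟩
  refine (h1.comp h2).congr fun s => ?_
  simp only [Function.comp_apply, slope_def_module, fourierCoefficient_smul,
    fourierCoefficient_sub, add_sub_cancel, Complex.real_smul]
  push_cast
  rfl

/-! ### The wave equation for a single Fourier coefficient -/

/-- The solution of `u'' = - μ u`, `u 0 = 1`, `u' 0 = 0`. -/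
def waveCos (μ t : ℝ) : ℝ := Real.cos (Real.sqrt μ * t)

/-- The solution of `u'' = - μ u`, `u 0 = 0`, `u' 0 = 1`. -/
def waveSin (μ t : ℝ) : ℝ := if μ = 0 then t else Real.sin (Real.sqrt μ * t) / Real.sqrt μ

lemma waveCos_zero (μ : ℝ) : waveCos μ 0 = 1 := by simp [waveCos]

lemma waveSin_zero (μ : ℝ) : waveSin μ 0 = 0 := by simp [waveSin]

lemma abs_waveCos_le (μ t : ℝ) : |waveCos μ t| ≤ 1 := Real.abs_cos_le_one _

lemma abs_waveSin_le {μ : ℝ} (hμ : 0 ≤ μ) (t : ℝ) : |waveSin μ t| ≤ |t| := by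
  unfold waveSin
  split_ifs with h
  · exact le_rfl
  · have h1 : 0 < Real.sqrt μ := Real.sqrt_pos.2 (lt_of_le_of_ne hμ (Ne.symm h))
    rw [abs_div, abs_of_pos h1, div_le_iff₀ h1]
    calc |Real.sin (Real.sqrt μ * t)| ≤ |Real.sqrt μ * t| := Real.abs_sin_le_abs
      _ = |t| * Real.sqrt μ := by rw [abs_mul, abs_of_pos h1, mul_comm]

lemma waveSin_sq_mul_le {μ : ℝ} (hμ : 0 < μ) (t : ℝ) : waveSin μ t ^ 2 * μ ≤ 1 := by
  rw [waveSin, if_neg hμ.ne', div_pow, Real.sq_sqrt hμ.le, div_mul_cancel₀ _ hμ.ne']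
  exact Real.sin_sq_le_one _

lemma hasDerivAt_waveCos {μ : ℝ} (hμ : 0 ≤ μ) (t : ℝ) :
    HasDerivAt (waveCos μ) (-μ * waveSin μ t) t := by
  have h := ((hasDerivAt_id t).const_mul (Real.sqrt μ)).cos
  convert! h using 1
  unfold waveSin
  split_ifs with h0
  · simp [h0]
  · have h1 : Real.sqrt μ ≠ 0 := (Real.sqrt_pos.2 (lt_of_le_of_ne hμ (Ne.symm h0))).ne'
    simp only [id, mul_one]
    nth_rewrite 1 [← Real.mul_self_sqrt hμ]
    field_simp

lemma hasDerivAt_waveSin {μ : ℝ} (hμ : 0 ≤ μ) (t : ℝ) :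
    HasDerivAt (waveSin μ) (waveCos μ t) t := by
  by_cases h0 : μ = 0
  · subst h0
    have : waveSin 0 = fun t => t := by funext t; simp [waveSin]
    rw [this]
    simpa [waveCos] using hasDerivAt_id' t
  · have h1 : Real.sqrt μ ≠ 0 := (Real.sqrt_pos.2 (lt_of_le_of_ne hμ (Ne.symm h0))).ne'
    have h := (((hasDerivAt_id t).const_mul (Real.sqrt μ)).sin).div_const (Real.sqrt μ)
    have h2 : waveSin μ = fun t => Real.sin (Real.sqrt μ * t) / Real.sqrt μ := by
      funext t; simp [waveSin, h0]
    rw [h2]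
    convert! h using 1
    simp only [id, mul_one, waveCos]
    field_simp

lemma continuous_waveCos_left (t : ℝ) : Continuous fun μ => waveCos μ t := by
  unfold waveCos; fun_prop

/-- The solution of `u'' = - μ u`, `u 0 = a`, `u' 0 = b`. -/
def waveSol (μ : ℝ) (a b : ℂ) (t : ℝ) : ℂ := waveCos μ t * a + waveSin μ t * b

/-- The time derivative of `waveSol`. -/
def waveVel (μ : ℝ) (a b : ℂ) (t : ℝ) : ℂ := -μ * waveSin μ t * a + waveCos μ t * b

lemma hasDerivAt_waveSol {μ : ℝ} (hμ : 0 ≤ μ) (a b : ℂ) (t : ℝ) :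
    HasDerivAt (waveSol μ a b) (waveVel μ a b t) t := by
  have h := ((hasDerivAt_waveCos hμ t).ofReal_comp.mul_const a).add
    ((hasDerivAt_waveSin hμ t).ofReal_comp.mul_const b)
  convert! h using 1
  simp [waveVel]

lemma hasDerivAt_waveVel {μ : ℝ} (hμ : 0 ≤ μ) (a b : ℂ) (t : ℝ) :
    HasDerivAt (waveVel μ a b) (-μ * waveSol μ a b t) t := by
  have h := (((hasDerivAt_waveSin hμ t).ofReal_comp.const_mul (-(μ : ℂ))).mul_const a).add
    ((hasDerivAt_waveCos hμ t).ofReal_comp.mul_const b)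
  convert! h using 1
  simp [waveSol]
  ring

lemma norm_waveSol_le {μ : ℝ} (hμ : 0 ≤ μ) (a b : ℂ) {t D : ℝ} (hD : 1 + |t| ≤ D) :
    ‖waveSol μ a b t‖ ≤ D * (‖a‖ + ‖b‖) := by
  refine (norm_add_le _ _).trans ?_
  rw [norm_mul, norm_mul, Complex.norm_real, Complex.norm_real, Real.norm_eq_abs,
    Real.norm_eq_abs, mul_add]
  have h1 := abs_waveCos_le μ t
  have h2 := abs_waveSin_le hμ t
  have h3 := abs_nonneg t
  gcongr <;> linarith

lemma norm_waveVel_le {μ : ℝ} (hμ : 0 ≤ μ) (a b : ℂ) {t D : ℝ} (hD : 1 + |t| ≤ D) :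
    ‖waveVel μ a b t‖ ≤ D * ((1 + μ) * (‖a‖ + ‖b‖)) := by
  refine (norm_add_le _ _).trans ?_
  rw [norm_mul, norm_mul, norm_mul, norm_neg, Complex.norm_real, Complex.norm_real,
    Complex.norm_real, Real.norm_eq_abs, Real.norm_eq_abs, Real.norm_eq_abs, abs_of_nonneg hμ,
    mul_add, mul_add]
  have h1 := abs_waveCos_le μ t
  have h2 := abs_waveSin_le hμ t
  have h3 := abs_nonneg t
  rw [← mul_assoc, ← mul_assoc]
  gcongr ?_ * _ + ?_ * _
  · rw [mul_comm D]; gcongr <;> linarith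
  · nlinarith

/-- Uniqueness for `u'' = - μ u` on the half-line. -/
lemma eq_waveSol {μ : ℝ} (hμ : 0 ≤ μ) {u v w : ℝ → ℂ}
    (hu : ∀ t, 0 ≤ t → HasDerivWithinAt u (v t) (Set.Ici 0) t)
    (hv : ∀ t, 0 ≤ t → HasDerivWithinAt v (w t) (Set.Ici 0) t)
    (hw : ∀ t, 0 < t → w t = -μ * u t) {t : ℝ} (ht : 0 ≤ t) :
    u t = waveSol μ (u 0) (v 0) t := by
  rcases ht.eq_or_lt with rfl | ht
  · simp [waveSol, waveCos_zero, waveSin_zero]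
  -- `P s` is the value at time `t` of the exact solution started at time `s` from `(u s, v s)`. The
  -- equation makes it constant in `s`, while `P t = u t` and `P 0` is the claimed formula.
  obtain ⟨P, hPs⟩ : ∃ P : ℝ → ℂ, P = fun s => waveCos μ (t - s) * u s + waveSin μ (t - s) * v s :=
    ⟨_, rfl⟩
  have hc (s : ℝ) : HasDerivAt (fun s => (waveCos μ (t - s) : ℂ)) (μ * waveSin μ (t - s)) s := by
    have h := ((hasDerivAt_waveCos hμ (t - s)).comp_const_sub t s).ofReal_comp
    convert! h using 1
    push_cast
    ring
  have hs (s : ℝ) : HasDerivAt (fun s => (waveSin μ (t - s) : ℂ)) (-waveCos μ (t - s)) s := by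
    have h := ((hasDerivAt_waveSin hμ (t - s)).comp_const_sub t s).ofReal_comp
    convert! h using 1
    push_cast
    ring
  have hP (s : ℝ) (hs0 : 0 ≤ s) : HasDerivWithinAt P
      (μ * waveSin μ (t - s) * u s + waveSin μ (t - s) * w s) (Set.Ici 0) s := by
    have h := ((hc s).hasDerivWithinAt.mul (hu s hs0)).add
      ((hs s).hasDerivWithinAt.mul (hv s hs0))
    rw [hPs]
    convert! h using 1
    ring
  have hPc : ContinuousOn P (Set.Icc 0 t) := fun s hs0 =>
    ((hP s hs0.1).continuousWithinAt).mono fun x hx => hx.1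
  -- The equation is only assumed at positive times, so constancy is proved on the open interval and
  -- carried to `0` by continuity.
  have key : Set.EqOn P (fun _ => P t) (Set.Ioo 0 t) := by
    intro s hs0
    suffices this : P t = P s from this.symm
    refine constant_of_has_deriv_right_zero (f := P) (a := s) (b := t)
      (hPc.mono (Set.Icc_subset_Icc_left hs0.1.le)) ?_ t ⟨hs0.2.le, le_rfl⟩
    intro x hx
    have hx0 : 0 < x := hs0.1.trans_le hx.1
    have h := (hP x hx0.le).mono (Set.Ici_subset_Ici.2 hx0.le)
    have e : μ * waveSin μ (t - x) * u x + waveSin μ (t - x) * w x = 0 := by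
      rw [hw x hx0]; ring
    rwa [e] at h
  have h0 : P 0 = P t := by
    have hcl : closure (Set.Ioo 0 t) = Set.Icc 0 t := closure_Ioo ht.ne
    exact key.of_subset_closure hPc continuousOn_const Set.Ioo_subset_Icc_self hcl.ge
      (Set.left_mem_Icc.2 ht.le)
  simp only [hPs, sub_self, sub_zero, waveCos_zero, waveSin_zero] at h0
  rw [waveSol, h0]
  simp

/-- The mean value inequality is applied twice, to `F'` and to `s ↦ F s - s F' t`. Unordered
intervals cover both signs of `h`. -/
lemma norm_diff_quotient_sub_le {F F' F'' : ℝ → ℂ} (hF : ∀ s, HasDerivAt F (F' s) s)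
    (hF' : ∀ s, HasDerivAt F' (F'' s) s) {t h M : ℝ} (hh : h ≠ 0)
    (hM : ∀ s, |s - t| ≤ |h| → ‖F'' s‖ ≤ M) :
    ‖(h : ℂ)⁻¹ * (F (t + h) - F t) - F' t‖ ≤ |h| * M := by
  have hseg : ∀ s ∈ Set.uIcc t (t + h), |s - t| ≤ |h| := fun s hs => by
    simpa using Set.abs_sub_left_of_mem_uIcc hs
  have h1 : ∀ s ∈ Set.uIcc t (t + h), ‖F' s - F' t‖ ≤ |h| * M := fun s hs => by
    have h2 := (convex_uIcc t (t + h)).norm_image_sub_le_of_norm_hasDerivWithin_le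
      (f := F') (f' := F'') (C := M) (fun x _ => (hF' x).hasDerivWithinAt)
      (fun x hx => hM x (hseg x hx)) Set.left_mem_uIcc hs
    refine h2.trans ?_
    rw [mul_comm, Real.norm_eq_abs]
    have hM0 : 0 ≤ M := (norm_nonneg _).trans (hM t (by simp))
    exact mul_le_mul_of_nonneg_right (hseg s hs) hM0
  have h2 := (convex_uIcc t (t + h)).norm_image_sub_le_of_norm_hasDerivWithin_le
    (f := fun s => F s - s * F' t) (f' := fun s => F' s - F' t) (C := |h| * M) (fun x _ => by
      have := (hF x).sub ((Complex.ofRealCLM.hasDerivAt (x := x)).mul_const (F' t))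
      simpa using! this.hasDerivWithinAt)
    h1 Set.left_mem_uIcc Set.right_mem_uIcc
  have hh' : (h : ℂ) ≠ 0 := by exact_mod_cast hh
  have h3 : (h : ℂ)⁻¹ * (F (t + h) - F t) - F' t =
      (h : ℂ)⁻¹ * ((F (t + h) - (t + h : ℝ) * F' t) - (F t - t * F' t)) := by
    push_cast
    field_simp
    ring
  rw [h3, norm_mul, norm_inv, Complex.norm_real, Real.norm_eq_abs]
  have hpos : 0 < |h| := abs_pos.2 hh
  rw [inv_mul_le_iff₀ hpos]
  simpa [mul_comm] using h2

/-! ### Wave equations for Fourier multipliers -/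

/-- The Fourier coefficients of a solution of a wave equation `U'' = A U`, where `A` is the Fourier
multiplier `-μ`. -/
theorem IsWaveSolution.fourierCoefficient_eq {n : ℕ}
    {A : PeriodicDistribution n → PeriodicDistribution n → Prop} {μ : (Fin n → ℤ) → ℝ}
    (hμ : ∀ k, 0 ≤ μ k)
    (hA : ∀ T S, A T S → ∀ k, fourierCoefficient S k = -μ k * fourierCoefficient T k)
    {f g : PeriodicDistribution n} {U : ℝ → PeriodicDistribution n} (hU : IsWaveSolution A f g U)
    {t : ℝ} (ht : 0 ≤ t) (k : Fin n → ℤ) :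
    fourierCoefficient (U t) k =
      waveSol (μ k) (fourierCoefficient f k) (fourierCoefficient g k) t := by
  obtain ⟨q, V, W, -, hUV, hVW, hAUW, rfl, rfl⟩ := hU
  exact eq_waveSol (hμ k) (u := fun t => fourierCoefficient (U t) k)
    (fun t ht => (hUV t ht).hasDerivWithinAt_fourierCoefficient k)
    (fun t ht => (hVW t ht).hasDerivWithinAt_fourierCoefficient k)
    (fun t ht => hA _ _ (hAUW t ht) k) ht

/-- The coefficientwise remainders are `O(|h|)` with constants square-summable against the weight,
so they add up in `H^q`. The scalar functions `F k` live on all of `ℝ`, which allows a two-sided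
bound on `F''` even at `t = 0`. -/
lemma hasDerivH_of_norm_le {n : ℕ} {q D t : ℝ} {U : ℝ → PeriodicDistribution n}
    {V : PeriodicDistribution n} {F F' F'' : (Fin n → ℤ) → ℝ → ℂ} {B : (Fin n → ℤ) → ℝ}
    (hU : ∀ s, 0 ≤ s → ∀ k, fourierCoefficient (U s) k = F k s)
    (hV : ∀ k, fourierCoefficient V k = F' k t)
    (hF : ∀ k s, HasDerivAt (F k) (F' k s) s) (hF' : ∀ k s, HasDerivAt (F' k) (F'' k s) s)
    (ht : 0 ≤ t) (hUq : ∀ s, 0 ≤ s → MemH q (U s)) (hVq : MemH q V) (hD : 0 ≤ D)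
    (hB : Summable fun k => weight k ^ q * B k ^ 2)
    (hM : ∀ k s, |s - t| ≤ 1 → ‖F'' k s‖ ≤ D * B k) : HasDerivH q U V t := by
  have hl : ∀ᶠ h : ℝ in 𝓝[{h | h ≠ 0 ∧ 0 ≤ t + h}] 0, |h| ≤ 1 := by
    refine nhdsWithin_le_nhds ?_
    filter_upwards [Metric.closedBall_mem_nhds (0 : ℝ) one_pos] with h hh
    simpa using hh
  refine tendstoH_of_norm_sub_le (r := fun h => |h| * D) (B := B) hVq ?_ ?_ ?_ hB ?_
  · filter_upwards [self_mem_nhdsWithin] with h hh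
    have h1 := (hUq _ hh.2).sub (hUq _ ht)
    refine MemH.of_le (C := ‖(h : ℂ)⁻¹‖ ^ 2) h1 fun k => ?_
    rw [fourierCoefficient_smul, norm_mul, mul_pow]
  · have : Tendsto (fun h : ℝ => |h| * D) (𝓝 0) (𝓝 (|0| * D)) :=
      (continuous_abs.mul continuous_const).tendsto 0
    rw [abs_zero, zero_mul] at this
    exact this.mono_left nhdsWithin_le_nhds
  · exact Eventually.of_forall fun h => mul_nonneg (abs_nonneg h) hD
  · filter_upwards [self_mem_nhdsWithin, hl] with h hh hh1 k
    rw [fourierCoefficient_smul, fourierCoefficient_sub, hU _ hh.2, hU _ ht, hV, mul_assoc]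
    exact norm_diff_quotient_sub_le (hF k) (hF' k) hh.1 fun s hs => hM k s (hs.trans hh1)

/-- Existence of solutions of a wave equation `U'' = A U`, where `A` is the Fourier multiplier `-μ`
with `μ` nonnegative and polynomially bounded. -/
theorem exists_isWaveSolution {n : ℕ}
    {A : PeriodicDistribution n → PeriodicDistribution n → Prop} {μ : (Fin n → ℤ) → ℝ}
    (hμ : ∀ k, 0 ≤ μ k) {C : ℝ} {p : ℕ} (hμC : ∀ k, 1 + μ k ≤ C * weight k ^ p)
    (hA : ∀ T : PeriodicDistribution n, ∀ q, MemH q T →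
      ∃ S, A T S ∧ ∀ k, fourierCoefficient S k = -μ k * fourierCoefficient T k)
    {f g : PeriodicDistribution n} {s₁ s₂ : ℝ} (hf : MemH s₁ f) (hg : MemH s₂ g) :
    ∃ U, IsWaveSolution A f g U := by
  obtain ⟨C₁, p₁, hC₁, hf'⟩ := hf.exists_norm_fourierCoefficient_le
  obtain ⟨C₂, p₂, hC₂, hg'⟩ := hg.exists_norm_fourierCoefficient_le
  set a := fourierCoefficient f with ha
  set b := fourierCoefficient g with hb
  -- One majorant for position, velocity, acceleration and the third derivative, up to a factor
  -- depending on time. The third derivative costs the most, namely `(1 + μ)²`.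
  set N : (Fin n → ℤ) → ℝ := fun k => (1 + μ k) ^ 2 * (‖a k‖ + ‖b k‖) with hN
  have hN1 (k) : (1 + μ k) * (‖a k‖ + ‖b k‖) ≤ N k := by
    have := hμ k
    exact mul_le_mul_of_nonneg_right (by nlinarith) (by positivity)
  have hN0 (k) : ‖a k‖ + ‖b k‖ ≤ N k := by
    refine le_trans ?_ (hN1 k)
    exact le_mul_of_one_le_left (by positivity) (by linarith [hμ k])
  have hC : 0 ≤ C := by
    have h1 := hμC 0
    have h2 := pow_pos (weight_pos (0 : Fin n → ℤ)) p
    by_contra! h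
    nlinarith [hμ 0]
  have hNw (k) : N k ≤ C ^ 2 * (C₁ + C₂) * weight k ^ (2 * p + p₁ + p₂) := by
    have hw := one_le_weight k
    have h0 := hμ k
    calc N k ≤ (C * weight k ^ p) ^ 2 * (C₁ * weight k ^ p₁ + C₂ * weight k ^ p₂) := by
          have h1 := hμC k; have h2 := hf' k; have h3 := hg' k
          simp only [hN]
          gcongr
      _ ≤ (C * weight k ^ p) ^ 2 * (C₁ * weight k ^ (p₁ + p₂) + C₂ * weight k ^ (p₁ + p₂)) := by
          gcongr <;> first | exact hw | omega
      _ = _ := by ring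
  -- `N²` contains `(1 + μ)⁴`, bounded by a multiple of `weight ^ (4 p)`.
  set q : ℝ := min s₁ s₂ - 4 * p with hq
  have hNs : Summable fun k => weight k ^ q * N k ^ 2 := by
    have h1 := memH_iff.1 (hf.mono (min_le_left s₁ s₂))
    have h2 := memH_iff.1 (hg.mono (min_le_right s₁ s₂))
    refine Summable.of_nonneg_of_le (fun k => mul_nonneg (weight_rpow_pos k q).le (sq_nonneg _))
      (fun k => ?_) ((h1.add h2).mul_left (2 * C ^ 4))
    have hw := weight_pos k
    have h0 := hμ k
    have h3 : weight k ^ q * weight k ^ (4 * p) = weight k ^ min s₁ s₂ := by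
      rw [← Real.rpow_natCast, ← Real.rpow_add hw, hq]
      push_cast
      ring_nf
    calc weight k ^ q * N k ^ 2 = weight k ^ q * ((1 + μ k) ^ 4 * (‖a k‖ + ‖b k‖) ^ 2) := by
          simp only [hN]; ring
      _ ≤ weight k ^ q * ((C * weight k ^ p) ^ 4 * (2 * (‖a k‖ ^ 2 + ‖b k‖ ^ 2))) := by
          have h4 := hμC k
          have h5 : (‖a k‖ + ‖b k‖) ^ 2 ≤ 2 * (‖a k‖ ^ 2 + ‖b k‖ ^ 2) := by
            nlinarith [sq_nonneg (‖a k‖ - ‖b k‖)]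
          have h6 := (weight_rpow_pos k q).le
          gcongr
      _ = 2 * C ^ 4 * (weight k ^ q * weight k ^ (4 * p)) * (‖a k‖ ^ 2 + ‖b k‖ ^ 2) := by ring
      _ = _ := by rw [h3]; ring
  have hsol (t : ℝ) {D : ℝ} (hD : 1 + |t| ≤ D) (k) : ‖waveSol (μ k) (a k) (b k) t‖ ≤ D * N k := by
    have hD0 : 0 ≤ D := by linarith [abs_nonneg t]
    exact (norm_waveSol_le (hμ k) _ _ hD).trans (mul_le_mul_of_nonneg_left (hN0 k) hD0)
  have hvel (t : ℝ) {D : ℝ} (hD : 1 + |t| ≤ D) (k) : ‖waveVel (μ k) (a k) (b k) t‖ ≤ D * N k := by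
    have hD0 : 0 ≤ D := by linarith [abs_nonneg t]
    exact (norm_waveVel_le (hμ k) _ _ hD).trans (mul_le_mul_of_nonneg_left (hN1 k) hD0)
  have hacc (t : ℝ) {D : ℝ} (hD : 1 + |t| ≤ D) (k) :
      ‖-μ k * waveSol (μ k) (a k) (b k) t‖ ≤ D * N k := by
    have hD0 : 0 ≤ D := by linarith [abs_nonneg t]
    have h0 := hμ k
    rw [norm_mul, norm_neg, Complex.norm_real, Real.norm_of_nonneg h0]
    calc μ k * ‖waveSol (μ k) (a k) (b k) t‖ ≤ (1 + μ k) * (D * (‖a k‖ + ‖b k‖)) := by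
          gcongr
          · linarith
          · exact norm_waveSol_le h0 _ _ hD
      _ = D * ((1 + μ k) * (‖a k‖ + ‖b k‖)) := by ring
      _ ≤ _ := mul_le_mul_of_nonneg_left (hN1 k) hD0
  have hjerk (t : ℝ) {D : ℝ} (hD : 1 + |t| ≤ D) (k) :
      ‖-μ k * waveVel (μ k) (a k) (b k) t‖ ≤ D * N k := by
    have h0 := hμ k
    rw [norm_mul, norm_neg, Complex.norm_real, Real.norm_of_nonneg h0]
    calc μ k * ‖waveVel (μ k) (a k) (b k) t‖ ≤
          (1 + μ k) * (D * ((1 + μ k) * (‖a k‖ + ‖b k‖))) := by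
          gcongr
          · linarith
          · exact norm_waveVel_le h0 _ _ hD
      _ = D * N k := by simp only [hN]; ring
  have hpoly {c : (Fin n → ℤ) → ℂ} {D : ℝ} (hD : 0 ≤ D) (hc : ∀ k, ‖c k‖ ≤ D * N k) (k) :
      ‖c k‖ ≤ (D * (C ^ 2 * (C₁ + C₂))) * weight k ^ (2 * p + p₁ + p₂) := by
    rw [mul_assoc]
    exact (hc k).trans (mul_le_mul_of_nonneg_left (hNw k) hD)
  -- At `t = 0` the datum itself is chosen, so that `U 0 = f` holds as distributions without appeal
  -- to injectivity of the Fourier coefficients.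
  have hU (t : ℝ) : ∃ T : PeriodicDistribution n,
      (∀ k, fourierCoefficient T k = waveSol (μ k) (a k) (b k) t) ∧ (t = 0 → T = f) := by
    by_cases ht : t = 0
    · exact ⟨f, fun k => by simp [waveSol, ht, waveCos_zero, waveSin_zero, ha], fun _ => rfl⟩
    · obtain ⟨T, hT⟩ := exists_fourierCoefficient_eq
        (hpoly (by positivity : 0 ≤ 1 + |t|) (hsol t le_rfl))
      exact ⟨T, hT, fun h => absurd h ht⟩
  have hV (t : ℝ) : ∃ T : PeriodicDistribution n,
      (∀ k, fourierCoefficient T k = waveVel (μ k) (a k) (b k) t) ∧ (t = 0 → T = g) := by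
    by_cases ht : t = 0
    · exact ⟨g, fun k => by simp [waveVel, ht, waveCos_zero, waveSin_zero, hb], fun _ => rfl⟩
    · obtain ⟨T, hT⟩ := exists_fourierCoefficient_eq
        (hpoly (by positivity : 0 ≤ 1 + |t|) (hvel t le_rfl))
      exact ⟨T, hT, fun h => absurd h ht⟩
  choose U hU hU0 using hU
  choose V hV hV0 using hV
  have hUq (t : ℝ) : MemH q (U t) :=
    MemH.of_norm_le hNs fun k => by rw [hU]; exact hsol t le_rfl k
  have hVq (t : ℝ) : MemH q (V t) :=
    MemH.of_norm_le hNs fun k => by rw [hV]; exact hvel t le_rfl k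
  have hW (t : ℝ) := hA (U t) q (hUq t)
  choose W hAW hW using hW
  have hWk (t : ℝ) (k) : fourierCoefficient (W t) k = -μ k * waveSol (μ k) (a k) (b k) t := by
    rw [hW, hU]
  have hWq (t : ℝ) : MemH q (W t) :=
    MemH.of_norm_le hNs fun k => by rw [hWk]; exact hacc t le_rfl k
  have hs {s t : ℝ} (h : |s - t| ≤ 1) : 1 + |s| ≤ 2 + |t| := by
    linarith [abs_sub_abs_le_abs_sub s t]
  refine ⟨U, q, V, W, fun t _ => hUq t, fun t ht => ?_, fun t ht => ?_, fun t _ => hAW t,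
    hU0 0 rfl, hV0 0 rfl⟩
  · exact hasDerivH_of_norm_le (fun s _ => hU s) (hV t) (fun k => hasDerivAt_waveSol (hμ k) _ _)
      (fun k => hasDerivAt_waveVel (hμ k) _ _) ht (fun s _ => hUq s) (hVq t)
      (by positivity : 0 ≤ 2 + |t|) hNs fun k s h => hacc s (hs h) k
  · refine hasDerivH_of_norm_le (fun s _ => hV s) (hWk t)
      (fun k => hasDerivAt_waveVel (hμ k) _ _)
      (fun k s => (hasDerivAt_waveSol (hμ k) _ _ s).const_mul (-(μ k : ℂ))) ht (fun s _ => hVq s)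
      (hWq t) (by positivity : 0 ≤ 2 + |t|) hNs fun k s h => hjerk s (hs h) k

/-! ### Sobolev regularity and convergence from bounds on `waveSin` -/

lemma norm_waveSol_sq_le (μ : ℝ) (a b : ℂ) (t : ℝ) :
    ‖waveSol μ a b t‖ ^ 2 ≤ 2 * (‖a‖ ^ 2 + waveSin μ t ^ 2 * ‖b‖ ^ 2) := by
  refine (norm_add_sq_le _ _).trans ?_
  rw [norm_mul, norm_mul, Complex.norm_real, Complex.norm_real, mul_pow, mul_pow,
    Real.norm_eq_abs, Real.norm_eq_abs, sq_abs, sq_abs]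
  have h := sq_le_one_iff_abs_le_one _ |>.2 (abs_waveCos_le μ t)
  gcongr
  exact mul_le_of_le_one_left (sq_nonneg _) h

/-- `waveSin` gains `σ` derivatives as soon as `μ` is bounded below by a multiple of
`‖k‖ ^ (2 σ)`. -/
lemma waveSin_sq_le {n : ℕ} {μ : (Fin n → ℤ) → ℝ} (hμ : ∀ k, 0 ≤ μ k) {c σ : ℝ} (hc : 0 < c)
    (h : ∀ k, k ≠ 0 → c * (‖latticePoint k‖ ^ 2) ^ σ ≤ μ k) (hσ : 0 ≤ σ) (t : ℝ) (k : Fin n → ℤ) :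
    waveSin (μ k) t ^ 2 ≤ (t ^ 2 + 2 ^ σ / c) * weight k ^ (-σ) := by
  by_cases hk : k = 0
  -- At frequency zero `μ` may vanish and only `|waveSin| ≤ |t|` is available, whence the term `t²`
  -- in the constant. The factor `2 ^ σ` comes from `weight k ≤ 2 ‖k‖²` at the other frequencies.
  · subst hk
    rw [show weight (0 : Fin n → ℤ) = 1 by simp [weight, latticePoint_zero], Real.one_rpow, mul_one]
    have h1 : 0 < 2 ^ σ / c := by positivity
    have h2 := sq_le_sq.2 (abs_waveSin_le (hμ 0) t)
    linarith
  · have hw := weight_pos k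
    have h1 : 0 < ‖latticePoint k‖ ^ 2 := by nlinarith [one_le_norm_latticePoint hk]
    have h2 : c * weight k ^ σ ≤ 2 ^ σ * μ k := by
      calc c * weight k ^ σ ≤ c * (2 * ‖latticePoint k‖ ^ 2) ^ σ := by
            gcongr; exact weight_le_two_mul hk
        _ = 2 ^ σ * (c * (‖latticePoint k‖ ^ 2) ^ σ) := by
            rw [Real.mul_rpow (by norm_num) h1.le]; ring
        _ ≤ _ := by gcongr; exact h k hk
    have hμk : 0 < μ k := lt_of_lt_of_le (by positivity) (h k hk)
    have h3 := waveSin_sq_mul_le hμk t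
    have h4 : waveSin (μ k) t ^ 2 * (c * weight k ^ σ) ≤ 2 ^ σ := by
      calc _ ≤ waveSin (μ k) t ^ 2 * (2 ^ σ * μ k) := by gcongr
        _ = 2 ^ σ * (waveSin (μ k) t ^ 2 * μ k) := by ring
        _ ≤ 2 ^ σ * 1 := by gcongr
        _ = _ := mul_one _
    have hwσ := weight_rpow_pos k σ
    calc waveSin (μ k) t ^ 2 ≤ 2 ^ σ / c * weight k ^ (-σ) := by
          rw [Real.rpow_neg hw.le, ← div_eq_mul_inv, div_div, le_div_iff₀ (by positivity)]
          exact h4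
      _ ≤ _ := by
          gcongr
          linarith [sq_nonneg t]

lemma summable_weight_mul_add {n : ℕ} {s₁ s₂ σ : ℝ} {f g : PeriodicDistribution n}
    (hf : MemH s₁ f) (hg : MemH s₂ g) : Summable fun k => weight k ^ min s₁ (s₂ + σ) *
      (‖fourierCoefficient f k‖ ^ 2 + weight k ^ (-σ) * ‖fourierCoefficient g k‖ ^ 2) := by
  have h1 := memH_iff.1 (hf.mono (min_le_left s₁ (s₂ + σ)))
  have h2 : Summable fun k => weight k ^ min s₁ (s₂ + σ) *
      (weight k ^ (-σ) * ‖fourierCoefficient g k‖ ^ 2) := by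
    refine Summable.of_nonneg_of_le (fun k => ?_) (fun k => ?_) (memH_iff.1 hg)
    · have := (weight_rpow_pos k (min s₁ (s₂ + σ))).le
      have := (weight_rpow_pos k (-σ)).le
      positivity
    · rw [← mul_assoc, ← Real.rpow_add (weight_pos k)]
      refine mul_le_mul_of_nonneg_right ?_ (sq_nonneg _)
      refine Real.rpow_le_rpow_of_exponent_le (one_le_weight k) ?_
      linarith [min_le_right s₁ (s₂ + σ)]
  simpa only [mul_add] using h1.add h2

/-- Regularity of solutions in terms of bounds for `waveSin`. -/
lemma memH_of_waveSin_sq_le {n : ℕ} {s₁ s₂ σ K t : ℝ} {f g T : PeriodicDistribution n}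
    {μ : (Fin n → ℤ) → ℝ} (hf : MemH s₁ f) (hg : MemH s₂ g)
    (hT : ∀ k, fourierCoefficient T k =
      waveSol (μ k) (fourierCoefficient f k) (fourierCoefficient g k) t)
    (hK : ∀ k, waveSin (μ k) t ^ 2 ≤ K * weight k ^ (-σ)) :
    MemH (min s₁ (s₂ + σ)) T := by
  refine MemH.of_le (C := 2 * (1 + |K|)) (summable_weight_mul_add hf hg (σ := σ)) fun k => ?_
  rw [hT]
  refine (norm_waveSol_sq_le _ _ _ _).trans ?_
  have hw := (weight_rpow_pos k (-σ)).le
  have h1 : waveSin (μ k) t ^ 2 ≤ (1 + |K|) * weight k ^ (-σ) :=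
    (hK k).trans (mul_le_mul_of_nonneg_right (by linarith [le_abs_self K]) hw)
  have h2 := mul_le_mul_of_nonneg_right h1 (sq_nonneg ‖fourierCoefficient g k‖)
  have h3 : ‖fourierCoefficient f k‖ ^ 2 ≤ (1 + |K|) * ‖fourierCoefficient f k‖ ^ 2 :=
    le_mul_of_one_le_left (sq_nonneg _) (by linarith [abs_nonneg K])
  nlinarith

lemma continuousAt_waveSin_left {μ : ℝ} (hμ : 0 < μ) (t : ℝ) :
    ContinuousAt (fun μ => waveSin μ t) μ := by
  have h : (fun μ => waveSin μ t) =ᶠ[𝓝 μ] fun μ => Real.sin (Real.sqrt μ * t) / Real.sqrt μ := by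
    filter_upwards [lt_mem_nhds hμ] with x hx
    rw [waveSin, if_neg hx.ne']
  refine ContinuousAt.congr ?_ h.symm
  exact ContinuousAt.div (by fun_prop) (by fun_prop) (Real.sqrt_pos.2 hμ).ne'

/-- Convergence of solutions when the multipliers converge pointwise and satisfy a uniform bound. -/
lemma tendstoH_of_waveSin_sq_le {n : ℕ} {ι : Type*} {l : Filter ι} [l.IsCountablyGenerated]
    {s₁ s₂ σ K t : ℝ}
    {f g T : PeriodicDistribution n} {F : ι → PeriodicDistribution n}
    {μ : (Fin n → ℤ) → ℝ} {m : ι → (Fin n → ℤ) → ℝ} (hf : MemH s₁ f) (hg : MemH s₂ g)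
    (hT : ∀ k, fourierCoefficient T k =
      waveSol (μ k) (fourierCoefficient f k) (fourierCoefficient g k) t)
    (hF : ∀ᶠ i in l, ∀ k, fourierCoefficient (F i) k =
      waveSol (m i k) (fourierCoefficient f k) (fourierCoefficient g k) t)
    (hK : ∀ k, waveSin (μ k) t ^ 2 ≤ K * weight k ^ (-σ))
    (hKm : ∀ᶠ i in l, ∀ k, waveSin (m i k) t ^ 2 ≤ K * weight k ^ (-σ))
    (hμ : ∀ k, k ≠ 0 → 0 < μ k) (hμ0 : ∀ᶠ i in l, m i 0 = μ 0)
    (hm : ∀ k, Tendsto (fun i => m i k) l (𝓝 (μ k))) :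
    TendstoH (min s₁ (s₂ + σ)) F l T := by
  refine ⟨memH_of_waveSin_sq_le hf hg hT hK, ?_, ?_⟩
  · filter_upwards [hF, hKm] with i hi hKi
    exact memH_of_waveSin_sq_le hf hg hi hKi
  -- The constant is `2 · (2 + 2)`: a factor `2` for the square of a difference, and `2 (1 + |K|)`
  -- for each of the two solutions.
  have hsum := (summable_weight_mul_add hf hg (σ := σ)).mul_left (8 * (1 + |K|))
  have key : Tendsto (fun i => ∑' k, weight k ^ min s₁ (s₂ + σ) *
      ‖fourierCoefficient (F i - T) k‖ ^ 2) l (𝓝 (∑' _k : Fin n → ℤ, 0)) := by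
    refine tendsto_tsum_of_dominated_convergence hsum (fun k => ?_) ?_
    · have h1 : Tendsto (fun i => fourierCoefficient (F i - T) k) l (𝓝 0) := by
        have h2 : Tendsto (fun i => waveSol (m i k) (fourierCoefficient f k)
            (fourierCoefficient g k) t - waveSol (μ k) (fourierCoefficient f k)
            (fourierCoefficient g k) t) l (𝓝 0) := by
          rw [tendsto_sub_nhds_zero_iff]
          -- Continuity of `waveSin` in `μ` is used only at `μ > 0`; at frequency zero the
          -- multipliers eventually agree exactly.
          by_cases hk : k = 0
          · subst hk
            refine tendsto_const_nhds.congr' ?_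
            filter_upwards [hμ0] with i hi
            rw [hi]
          · have h3 := ((continuous_waveCos_left t).tendsto (μ k)).comp (hm k)
            have h4 := (continuousAt_waveSin_left (hμ k hk) t).tendsto.comp (hm k)
            exact (((Complex.continuous_ofReal.tendsto _).comp h3).mul_const _).add
              (((Complex.continuous_ofReal.tendsto _).comp h4).mul_const _)
        refine h2.congr' ?_
        filter_upwards [hF] with i hi
        rw [fourierCoefficient_sub, hi, hT]
      have h2 := ((h1.norm).pow 2).const_mul (weight k ^ min s₁ (s₂ + σ))
      simpa using h2
    · filter_upwards [hF, hKm] with i hi hKi k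
      have hq := (weight_rpow_pos k (min s₁ (s₂ + σ))).le
      rw [Real.norm_of_nonneg (mul_nonneg hq (sq_nonneg _)), mul_left_comm]
      refine mul_le_mul_of_nonneg_left ?_ hq
      rw [fourierCoefficient_sub, hi, hT]
      refine (norm_sub_sq_le _ _).trans ?_
      have hw := (weight_rpow_pos k (-σ)).le
      have bound {x : ℝ} (hx : waveSin x t ^ 2 ≤ K * weight k ^ (-σ)) :
          ‖waveSol x (fourierCoefficient f k) (fourierCoefficient g k) t‖ ^ 2 ≤
            2 * (1 + |K|) * (‖fourierCoefficient f k‖ ^ 2 +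
              weight k ^ (-σ) * ‖fourierCoefficient g k‖ ^ 2) := by
        refine (norm_waveSol_sq_le _ _ _ _).trans ?_
        have h1 : waveSin x t ^ 2 ≤ (1 + |K|) * weight k ^ (-σ) :=
          hx.trans (mul_le_mul_of_nonneg_right (by linarith [le_abs_self K]) hw)
        have h2 := mul_le_mul_of_nonneg_right h1 (sq_nonneg ‖fourierCoefficient g k‖)
        have h3 : ‖fourierCoefficient f k‖ ^ 2 ≤ (1 + |K|) * ‖fourierCoefficient f k‖ ^ 2 :=
          le_mul_of_one_le_left (sq_nonneg _) (by linarith [abs_nonneg K])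
        nlinarith
      nlinarith [bound (hKi k), bound (hK k)]
  rw [tsum_zero] at key
  have h := (Real.continuous_sqrt.tendsto 0).comp key
  rw [Real.sqrt_zero] at h
  exact h

/-! ### The multiplier as an integral -/

/-- The quadratic form `∫_{B_r(0)} (ν · z)² / ‖z‖^β dz`. -/
def ballMoment {n : ℕ} (β r : ℝ) (ν : E n) : ℝ :=
  ∫ z in Metric.ball (0 : E n) r, (inner ℝ ν z) ^ 2 / ‖z‖ ^ β

/-- Cauchy–Schwarz bounds the integrand by `‖ν‖² ‖z‖^(2-β)`, integrable at the origin because `β - 2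
< n`. -/
lemma integrableOn_inner_sq_div {n : ℕ} (hn : 1 ≤ n) {β : ℝ} (hβ : β < n + 2) (r : ℝ) (ν : E n) :
    MeasureTheory.IntegrableOn (fun z : E n => (inner ℝ ν z) ^ 2 / ‖z‖ ^ β)
      (Metric.ball 0 r) := by
  refine MeasureTheory.integrableOn_ball_of_norm_le_rpow (α := β - 2) (C := ‖ν‖ ^ 2)
    (by simpa using hn) (by simp; linarith) (Eventually.of_forall fun z => ?_) ?_
  · rcases eq_or_ne z 0 with rfl | hz
    · simp only [inner_zero_right, ne_eq, OfNat.ofNat_ne_zero, not_false_eq_true, zero_pow,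
        zero_div, norm_zero]
      positivity
    · have hz' : 0 < ‖z‖ := norm_pos_iff.2 hz
      rw [Real.norm_of_nonneg (by positivity), neg_sub, Real.rpow_sub hz', Real.rpow_ofNat,
        ← mul_div_assoc, ← mul_pow]
      refine div_le_div_of_nonneg_right ?_ (by positivity)
      exact sq_le_sq' (by linarith [(abs_le.1 (abs_real_inner_le_norm ν z)).1])
        (abs_le.1 (abs_real_inner_le_norm ν z)).2
  · refine Measurable.aestronglyMeasurable ?_
    fun_prop

/-- The reflection exchanging `ν` and `ν'` preserves the ball, the norm and the volume. -/
lemma ballMoment_eq_of_norm_eq {n : ℕ} (β r : ℝ) {ν ν' : E n} (h : ‖ν‖ = ‖ν'‖) :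
    ballMoment β r ν = ballMoment β r ν' := by
  let R : E n ≃ₗᵢ[ℝ] E n := (ℝ ∙ (ν - ν'))ᗮ.reflection
  have hR : R ν = ν' := Submodule.reflection_sub h
  have h1 := R.measurePreserving.setIntegral_preimage_emb
    R.toHomeomorph.measurableEmbedding (fun z => (inner ℝ ν' z) ^ 2 / ‖z‖ ^ β) (Metric.ball 0 r)
  rw [ballMoment, ballMoment, ← h1, R.preimage_ball, R.symm.map_zero]
  simp_rw [← hR, R.inner_map_map, R.norm_map]

lemma setIntegral_ball_norm {n : ℕ} (hn : 1 ≤ n) {β r : ℝ} (hβ : β < n + 2) (hr : 0 < r) :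
    ∫ z in Metric.ball (0 : E n) r, ‖z‖ ^ 2 / ‖z‖ ^ β =
      n * MeasureTheory.volume.real (Metric.ball (0 : E n) 1) *
        (r ^ ((n : ℝ) + 2 - β) / ((n : ℝ) + 2 - β)) := by
  have : Nontrivial (E n) := by
    apply Module.nontrivial_of_finrank_pos (R := ℝ)
    rw [finrank_euclideanSpace_fin]
    exact hn
  have h0 : ∫ z in Metric.ball (0 : E n) r, ‖z‖ ^ 2 / ‖z‖ ^ β =
      ∫ z : E n, (Set.Iio r).indicator (fun y : ℝ => y ^ 2 / y ^ β) ‖z‖ := by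
    rw [← MeasureTheory.integral_indicator measurableSet_ball]
    congr 1
    funext z
    simp [Set.indicator]
  rw [h0, MeasureTheory.integral_fun_norm_addHaar MeasureTheory.volume]
  have h1 : ∫ y in Set.Ioi (0 : ℝ), y ^ (Module.finrank ℝ (E n) - 1) •
      (Set.Iio r).indicator (fun y : ℝ => y ^ 2 / y ^ β) y =
      r ^ ((n : ℝ) + 2 - β) / ((n : ℝ) + 2 - β) := by
    have h2 : ∀ y ∈ Set.Ioi (0 : ℝ), y ^ (Module.finrank ℝ (E n) - 1) •
        (Set.Iio r).indicator (fun y : ℝ => y ^ 2 / y ^ β) y =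
        (Set.Iio r).indicator (fun y : ℝ => y ^ ((n : ℝ) + 1 - β)) y := by
      intro y hy
      have hy' : 0 < y := hy
      by_cases hyr : y ∈ Set.Iio r
      · rw [Set.indicator_of_mem hyr, Set.indicator_of_mem hyr, smul_eq_mul, ← mul_div_assoc,
          ← pow_add, Real.rpow_sub hy', finrank_euclideanSpace_fin]
        congr 1
        rw [← Real.rpow_natCast]
        congr 1
        have : n - 1 + 2 = n + 1 := by omega
        rw [this]
        push_cast
        rfl
      · rw [Set.indicator_of_notMem hyr, Set.indicator_of_notMem hyr, smul_zero]
    rw [MeasureTheory.setIntegral_congr_fun measurableSet_Ioi h2,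
      MeasureTheory.setIntegral_indicator measurableSet_Iio, Set.Ioi_inter_Iio,
      ← MeasureTheory.integral_Ioc_eq_integral_Ioo, ← intervalIntegral.integral_of_le hr.le,
      integral_rpow (Or.inl (by linarith))]
    have h3 : (n : ℝ) + 1 - β + 1 = n + 2 - β := by ring
    rw [h3, Real.zero_rpow (by linarith), sub_zero]
  rw [h1, finrank_euclideanSpace_fin]
  simp [mul_assoc]

/-- By rotation invariance, `n` times the moment is its sum over the coordinate directions scaled by
`‖ν‖`, which replaces `(ν · z)²` by `‖ν‖² ‖z‖²` and leaves a radial integral. -/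
lemma ballMoment_eq {n : ℕ} (hn : 1 ≤ n) {β r : ℝ} (hβ : β < n + 2) (hr : 0 < r) (ν : E n) :
    ballMoment β r ν = ‖ν‖ ^ 2 * MeasureTheory.volume.real (Metric.ball (0 : E n) 1) *
        (r ^ ((n : ℝ) + 2 - β) / ((n : ℝ) + 2 - β)) := by
  have hn0 : (n : ℝ) ≠ 0 := by positivity
  have h1 : (n : ℝ) * ballMoment β r ν =
      ∑ i : Fin n, ballMoment β r (‖ν‖ • EuclideanSpace.single i (1 : ℝ)) := by
    rw [Finset.sum_congr rfl fun i _ => ballMoment_eq_of_norm_eq β r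
      (show ‖‖ν‖ • EuclideanSpace.single i (1 : ℝ)‖ = ‖ν‖ by simp [norm_smul])]
    simp
  have h2 : ∑ i : Fin n, ballMoment β r (‖ν‖ • EuclideanSpace.single i (1 : ℝ)) =
      ‖ν‖ ^ 2 * ∫ z in Metric.ball (0 : E n) r, ‖z‖ ^ 2 / ‖z‖ ^ β := by
    unfold ballMoment
    rw [← MeasureTheory.integral_finsetSum _ fun i _ => integrableOn_inner_sq_div hn hβ r _,
      ← MeasureTheory.integral_const_mul]
    congr 1
    funext z
    rw [← Finset.sum_div, EuclideanSpace.norm_sq_eq z, ← mul_div_assoc, Finset.mul_sum]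
    simp [inner_smul_left, EuclideanSpace.inner_single_left, mul_pow]
  rw [h2, setIntegral_ball_norm hn hβ hr] at h1
  refine mul_left_cancel₀ hn0 (h1.trans ?_)
  ring

lemma volume_real_unit_ball {n : ℕ} (hn : 1 ≤ n) :
    MeasureTheory.volume.real (Metric.ball (0 : E n) 1) =
      Real.pi ^ ((n : ℝ) / 2) / Real.Gamma ((n : ℝ) / 2 + 1) := by
  have : Nonempty (Fin n) := ⟨⟨0, hn⟩⟩
  have hG : 0 < Real.Gamma ((n : ℝ) / 2 + 1) := Real.Gamma_pos_of_pos (by positivity)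
  rw [MeasureTheory.measureReal_def, EuclideanSpace.volume_ball, ENNReal.ofReal_one, one_pow,
    one_mul, Fintype.card_fin, ENNReal.toReal_ofReal (by positivity), Real.sqrt_eq_rpow,
    ← Real.rpow_natCast, ← Real.rpow_mul Real.pi_pos.le]
  ring_nf

lemma scalingConstant_pos {n : ℕ} {δ β : ℝ} (hδ : 0 < δ) (hβ : β < n + 2) :
    0 < scalingConstant n δ β := by
  have hG : 0 < Real.Gamma ((n : ℝ) / 2 + 1) := Real.Gamma_pos_of_pos (by positivity)
  have := Real.pi_pos
  have h : 0 < (n : ℝ) + 2 - β := by linarith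
  unfold scalingConstant
  positivity

/-- The scaling constant normalises the quadratic part: at `r = δ` the power is `1`. For fixed `r`
it tends to `1` as `β → n + 2`, so the kernel concentrates at the origin. -/
lemma scalingConstant_mul_ballMoment {n : ℕ} (hn : 1 ≤ n) {δ β r : ℝ} (hδ : 0 < δ)
    (hβ : β < n + 2) (hr : 0 < r) (ν : E n) :
    scalingConstant n δ β * ballMoment β r ν = 2 * ‖ν‖ ^ 2 * (r / δ) ^ ((n : ℝ) + 2 - β) := by
  have hG : 0 < Real.Gamma ((n : ℝ) / 2 + 1) := Real.Gamma_pos_of_pos (by positivity)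
  have h : 0 < (n : ℝ) + 2 - β := by linarith
  have hp : 0 < Real.pi ^ ((n : ℝ) / 2) := Real.rpow_pos_of_pos Real.pi_pos _
  have hd : 0 < δ ^ ((n : ℝ) + 2 - β) := Real.rpow_pos_of_pos hδ _
  rw [ballMoment_eq hn hβ hr, volume_real_unit_ball hn, scalingConstant, Real.div_rpow hr.le hδ.le]
  field_simp

/-! ### Two-sided bounds for the integral multiplier -/

lemma neg_multiplier_eq {n : ℕ} {δ β : ℝ} (hβ : β < n + 2) (ν : E n) :
    -multiplier δ β ν = scalingConstant n δ β *
      ∫ z in Metric.ball (0 : E n) δ, (1 - Real.cos (inner ℝ ν z)) / ‖z‖ ^ β := by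
  rw [multiplier, if_pos hβ, ← mul_neg, ← MeasureTheory.integral_neg]
  congr 2
  funext z
  ring

lemma integrableOn_one_sub_cos_div {n : ℕ} (hn : 1 ≤ n) {β : ℝ} (hβ : β < n + 2) (r : ℝ)
    (ν : E n) : MeasureTheory.IntegrableOn
      (fun z : E n => (1 - Real.cos (inner ℝ ν z)) / ‖z‖ ^ β) (Metric.ball 0 r) := by
  refine MeasureTheory.Integrable.mono' (integrableOn_inner_sq_div hn hβ r ν) ?_
    (Eventually.of_forall fun z => ?_)
  · refine Measurable.aestronglyMeasurable ?_
    fun_prop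
  · have h1 := Real.cos_le_one (inner ℝ ν z)
    have h2 := Real.one_sub_sq_div_two_le_cos (x := inner ℝ ν z)
    rw [Real.norm_of_nonneg (div_nonneg (by linarith) (by positivity))]
    exact div_le_div_of_nonneg_right (by nlinarith [sq_nonneg (inner ℝ ν z)]) (by positivity)

lemma neg_multiplier_le {n : ℕ} (hn : 1 ≤ n) {δ β : ℝ} (hδ : 0 < δ) (hβ : β < n + 2) (ν : E n) :
    -multiplier δ β ν ≤ ‖ν‖ ^ 2 := by
  have hc := scalingConstant_pos hδ hβ
  have h1 : ∫ z in Metric.ball (0 : E n) δ, (1 - Real.cos (inner ℝ ν z)) / ‖z‖ ^ β ≤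
      ∫ z in Metric.ball (0 : E n) δ, 1 / 2 * ((inner ℝ ν z) ^ 2 / ‖z‖ ^ β) := by
    refine MeasureTheory.integral_mono (integrableOn_one_sub_cos_div hn hβ δ ν)
      ((integrableOn_inner_sq_div hn hβ δ ν).const_mul _) fun z => ?_
    have h2 := Real.one_sub_sq_div_two_le_cos (x := inner ℝ ν z)
    simp only
    rw [← mul_div_assoc]
    exact div_le_div_of_nonneg_right (by linarith) (by positivity)
  rw [MeasureTheory.integral_const_mul] at h1
  rw [neg_multiplier_eq hβ]
  have h3 := scalingConstant_mul_ballMoment hn hδ hβ hδ ν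
  rw [div_self hδ.ne', Real.one_rpow, ballMoment] at h3
  have h4 := mul_le_mul_of_nonneg_left h1 hc.le
  linarith

/-- The integrand is nonnegative, so the integral may be cut down to a ball on which `|ν · z| ≤ 1`
and the Taylor expansion of cosine is effective. -/
lemma le_neg_multiplier {n : ℕ} (hn : 1 ≤ n) {δ β r : ℝ} (hδ : 0 < δ) (hβ : β < n + 2) (ν : E n)
    (hr : 0 < r) (hrδ : r ≤ δ) (hνr : ‖ν‖ * r ≤ 1) :
    ‖ν‖ ^ 2 * (r / δ) ^ ((n : ℝ) + 2 - β) * (1 - 5 / 48 * (‖ν‖ * r) ^ 2) ≤ -multiplier δ β ν := by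
  have hc := scalingConstant_pos hδ hβ
  have h0 : ∫ z in Metric.ball (0 : E n) r, (1 - Real.cos (inner ℝ ν z)) / ‖z‖ ^ β ≤
      ∫ z in Metric.ball (0 : E n) δ, (1 - Real.cos (inner ℝ ν z)) / ‖z‖ ^ β := by
    refine MeasureTheory.setIntegral_mono_set (integrableOn_one_sub_cos_div hn hβ δ ν)
      (Eventually.of_forall fun z => div_nonneg ?_ ?_)
      (Metric.ball_subset_ball hrδ).eventuallyLE
    · linarith [Real.cos_le_one (inner ℝ ν z)]
    · positivity
  have h1 : ∫ z in Metric.ball (0 : E n) r,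
      (1 / 2 * (1 - 5 / 48 * (‖ν‖ * r) ^ 2)) * ((inner ℝ ν z) ^ 2 / ‖z‖ ^ β) ≤
      ∫ z in Metric.ball (0 : E n) r, (1 - Real.cos (inner ℝ ν z)) / ‖z‖ ^ β := by
    refine MeasureTheory.setIntegral_mono_on ((integrableOn_inner_sq_div hn hβ r ν).const_mul _)
      (integrableOn_one_sub_cos_div hn hβ r ν) measurableSet_ball fun z hz => ?_
    have hz' : ‖z‖ ≤ r := (mem_ball_zero_iff.1 hz).le
    have h2 : |inner ℝ ν z| ≤ ‖ν‖ * r :=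
      (abs_real_inner_le_norm ν z).trans (by gcongr)
    -- The quartic error constant here is `5/96`; factoring out `x²/2` doubles it to `5/48`.
    have h3 := (abs_le.1 (Real.cos_bound (h2.trans hνr))).2
    have h4 : (inner ℝ ν z) ^ 2 ≤ (‖ν‖ * r) ^ 2 := by
      rw [← sq_abs]; gcongr
    have h5 : |inner ℝ ν z| ^ 4 = (inner ℝ ν z) ^ 2 * (inner ℝ ν z) ^ 2 := by
      rw [← sq_abs]; ring
    rw [h5] at h3
    have h6 := mul_le_mul_of_nonneg_left h4 (sq_nonneg (inner ℝ ν z))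
    rw [← mul_div_assoc]
    exact div_le_div_of_nonneg_right (by linarith) (by positivity)
  rw [MeasureTheory.integral_const_mul] at h1
  rw [neg_multiplier_eq hβ]
  have h3 := scalingConstant_mul_ballMoment hn hδ hβ hr ν
  rw [ballMoment] at h3
  have h4 := mul_le_mul_of_nonneg_left (h1.trans h0) hc.le
  refine le_of_eq_of_le ?_ h4
  rw [mul_left_comm, h3]
  ring

/-! ### Entire power series -/

/-- The sum of the power series with coefficients `c`. -/
def powerSum (c : ℕ → ℝ) (x : ℝ) : ℝ := ∑' j, c j * x ^ j

lemma summable_powerSum {c : ℕ → ℝ} {C : ℝ} (hc : ∀ j, |c j| ≤ C / j.factorial) (x : ℝ) :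
    Summable fun j => c j * x ^ j := by
  refine Summable.of_norm_bounded ((Real.summable_pow_div_factorial |x|).mul_left C) fun j => ?_
  rw [norm_mul, norm_pow, Real.norm_eq_abs, Real.norm_eq_abs]
  calc |c j| * |x| ^ j ≤ C / j.factorial * |x| ^ j := by gcongr; exact hc j
    _ = _ := by ring

lemma powerSum_zero (c : ℕ → ℝ) : powerSum c 0 = c 0 := by
  rw [powerSum, tsum_eq_single 0 fun j hj => by simp [hj]]
  simp

lemma powerSum_eq_add {c : ℕ → ℝ} {C : ℝ} (hc : ∀ j, |c j| ≤ C / j.factorial) (x : ℝ) :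
    powerSum c x = c 0 + x * powerSum (fun j => c (j + 1)) x := by
  rw [powerSum, (summable_powerSum hc x).tsum_eq_zero_add, powerSum, ← tsum_mul_left]
  simp only [pow_zero, mul_one, pow_succ]
  congr 2
  funext j
  ring

/-- The coefficients of the derivative of a power series. -/
def derivCoeff (c : ℕ → ℝ) (j : ℕ) : ℝ := (j + 1) * c (j + 1)

lemma abs_derivCoeff_le {c : ℕ → ℝ} {C : ℝ} (hc : ∀ j, |c j| ≤ C / j.factorial) (j : ℕ) :
    |derivCoeff c j| ≤ C / j.factorial := by
  have hj : (0 : ℝ) < j + 1 := by positivity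
  rw [derivCoeff, abs_mul, abs_of_pos hj]
  calc ((j : ℝ) + 1) * |c (j + 1)| ≤ (j + 1) * (C / (j + 1).factorial) := by
        gcongr; exact hc _
    _ = C / j.factorial := by
        rw [Nat.factorial_succ]; push_cast; field_simp

lemma hasDerivAt_powerSum {c : ℕ → ℝ} {C : ℝ} (hc : ∀ j, |c j| ≤ C / j.factorial) (x : ℝ) :
    HasDerivAt (powerSum c) (powerSum (derivCoeff c) x) x := by
  obtain ⟨R, hR⟩ : ∃ R, R = |x| + 1 := ⟨_, rfl⟩
  have hR0 : 0 < R := by rw [hR]; positivity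
  have hu : Summable fun j : ℕ => C / j.factorial * (j * R ^ (j - 1)) := by
    rw [← summable_nat_add_iff 1]
    refine ((Real.summable_pow_div_factorial R).mul_left C).congr fun j => ?_
    rw [Nat.factorial_succ, Nat.add_sub_cancel]
    push_cast
    field_simp
  have hx : x ∈ Metric.ball (0 : ℝ) R := by
    rw [mem_ball_zero_iff, Real.norm_eq_abs, hR]; linarith
  have h := hasDerivAt_tsum_of_isPreconnected (𝕜 := ℝ) (g := fun j y => c j * y ^ j)
    (g' := fun j y => c j * (j * y ^ (j - 1))) hu Metric.isOpen_ball
    (convex_ball (0 : ℝ) R).isPreconnected (fun j y _ => (hasDerivAt_pow j y).const_mul (c j))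
    (fun j y hy => ?_) hx (summable_powerSum hc x) hx
  · refine HasDerivAt.congr_deriv h ?_
    have hs : Summable fun j : ℕ => c j * (j * x ^ (j - 1)) := by
      rw [← summable_nat_add_iff 1]
      refine (summable_powerSum (abs_derivCoeff_le hc) x).congr fun j => ?_
      rw [derivCoeff, Nat.add_sub_cancel]
      push_cast
      ring
    rw [hs.tsum_eq_zero_add, powerSum]
    simp only [Nat.cast_zero, zero_mul, mul_zero, zero_add, Nat.add_sub_cancel]
    congr 1
    funext j
    rw [derivCoeff]
    push_cast
    ring
  · have hy' : |y| ≤ R := (mem_ball_zero_iff.1 hy).le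
    rw [norm_mul, norm_mul, norm_pow, Real.norm_eq_abs, Real.norm_eq_abs, Real.norm_eq_abs,
      Nat.abs_cast]
    have := hc j
    have hC0 : 0 ≤ C / j.factorial := (abs_nonneg _).trans this
    gcongr

/-- Euler's operator `x d/dx + a` acts on power series by multiplying the coefficients. -/
lemma mul_powerSum_derivCoeff_add {c d : ℕ → ℝ} {C a : ℝ} (hc : ∀ j, |c j| ≤ C / j.factorial)
    (h : ∀ j : ℕ, (j + a) * c j = d j) (x : ℝ) :
    x * powerSum (derivCoeff c) x + a * powerSum c x = powerSum d x := by
  have h1 : Summable fun j : ℕ => (j * c j) * x ^ j := by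
    rw [← summable_nat_add_iff 1]
    refine ((summable_powerSum (abs_derivCoeff_le hc) x).mul_left x).congr fun j => ?_
    rw [derivCoeff, pow_succ]
    push_cast
    ring
  have h2 : x * powerSum (derivCoeff c) x = ∑' j : ℕ, (j * c j) * x ^ j := by
    rw [h1.tsum_eq_zero_add, powerSum, ← tsum_mul_left]
    simp only [Nat.cast_zero, zero_mul, zero_add]
    congr 1
    funext j
    rw [derivCoeff, pow_succ]
    push_cast
    ring
  rw [h2, powerSum, powerSum, ← tsum_mul_left,
    ← h1.tsum_add ((summable_powerSum hc x).mul_left a)]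
  congr 1
  funext j
  rw [← h j]
  ring

/-! ### The Bessel-type functions `₀F₁ (; c; -x)` -/

lemma ascPochhammer_eval_succ_left (c : ℝ) (j : ℕ) :
    (ascPochhammer ℝ (j + 1)).eval c = c * (ascPochhammer ℝ j).eval (c + 1) := by
  simp [ascPochhammer_succ_left]

lemma one_le_ascPochhammer_eval {c : ℝ} (hc : 1 ≤ c) (j : ℕ) :
    1 ≤ (ascPochhammer ℝ j).eval c := by
  induction j with
  | zero => simp
  | succ j ih =>
    rw [ascPochhammer_succ_eval]
    have : (0 : ℝ) ≤ j := by positivity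
    nlinarith

/-- The threshold `1/2` is the value of `c = n/2` in dimension one. -/
lemma half_le_ascPochhammer_eval {c : ℝ} (hc : 1 / 2 ≤ c) (j : ℕ) :
    1 / 2 ≤ (ascPochhammer ℝ j).eval c := by
  cases j with
  | zero => norm_num
  | succ j =>
    rw [ascPochhammer_eval_succ_left]
    nlinarith [one_le_ascPochhammer_eval (by linarith : 1 ≤ c + 1) j]

/-- The coefficients of `₀F₁ (; c; -x)`. -/
def besselCoeff (c : ℝ) (j : ℕ) : ℝ :=
  (-1) ^ j / (j.factorial * (ascPochhammer ℝ j).eval c)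

/-- The function `₀F₁ (; c; -x)`. -/
def besselSum (c : ℝ) : ℝ → ℝ := powerSum (besselCoeff c)

lemma abs_besselCoeff_le {c : ℝ} (hc : 1 / 2 ≤ c) (j : ℕ) :
    |besselCoeff c j| ≤ 2 / j.factorial := by
  have h := half_le_ascPochhammer_eval hc j
  have hj : (0 : ℝ) < j.factorial := by positivity
  rw [besselCoeff, abs_div, abs_pow, abs_neg, abs_one, one_pow, abs_of_pos (by positivity),
    div_le_div_iff₀ (by positivity) hj]
  nlinarith

lemma hasDerivAt_besselSum {c : ℝ} (hc : 1 / 2 ≤ c) (x : ℝ) :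
    HasDerivAt (besselSum c) (-besselSum (c + 1) x / c) x := by
  refine (hasDerivAt_powerSum (abs_besselCoeff_le hc) x).congr_deriv ?_
  rw [besselSum, powerSum, powerSum, neg_div, ← tsum_div_const, ← tsum_neg]
  congr 1
  funext j
  have h := one_le_ascPochhammer_eval (by linarith : 1 ≤ c + 1) j
  have hc0 : 0 < c := by linarith
  rw [derivCoeff, besselCoeff, besselCoeff, ascPochhammer_eval_succ_left, Nat.factorial_succ,
    pow_succ]
  push_cast
  field_simp

/-- In view of `hasDerivAt_besselSum`, this is the Bessel-type equation `x F'' + c F' + F = 0` for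
`F = besselSum c`. -/
lemma mul_deriv_besselSum {c : ℝ} (hc : 1 / 2 ≤ c) (x : ℝ) :
    x * (-besselSum (c + 2) x / (c + 1)) + c * besselSum (c + 1) x = c * besselSum c x := by
  have hc1 : 1 / 2 ≤ c + 1 := by linarith
  have h1 := hasDerivAt_besselSum hc1 x
  rw [show c + 1 + 1 = c + 2 by ring] at h1
  rw [h1.unique (hasDerivAt_powerSum (abs_besselCoeff_le hc1) x), besselSum,
    mul_powerSum_derivCoeff_add (d := fun j => c * besselCoeff c j) (abs_besselCoeff_le hc1)
      (fun j => ?_) x, besselSum, powerSum, powerSum, ← tsum_mul_left]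
  · simp_rw [mul_assoc]
  · have h2 := ascPochhammer_eval_succ_left c j
    rw [ascPochhammer_succ_eval] at h2
    have h3 := one_le_ascPochhammer_eval (by linarith : 1 ≤ c + 1) j
    have h4 := half_le_ascPochhammer_eval hc j
    rw [besselCoeff, besselCoeff]
    field_simp
    linear_combination h2

lemma besselSum_zero (c : ℝ) : besselSum c 0 = 1 := by
  simp [besselSum, powerSum_zero, besselCoeff]

/-- The energy `F² + x F'²` has derivative `(1 - 2c) F'²`, nonpositive for `c ≥ 1/2`, and equals `1`
at the origin. -/
lemma abs_besselSum_le_one {c : ℝ} (hc : 1 / 2 ≤ c) {x : ℝ} (hx : 0 ≤ x) :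
    |besselSum c x| ≤ 1 := by
  have hc0 : 0 < c := by linarith
  have hd (y : ℝ) : HasDerivAt (fun y => besselSum c y ^ 2 + y * besselSum (c + 1) y ^ 2 / c ^ 2)
      (besselSum (c + 1) y ^ 2 * (1 - 2 * c) / c ^ 2) y := by
    have h1 := hasDerivAt_besselSum hc y
    have h2 := hasDerivAt_besselSum (by linarith : 1 / 2 ≤ c + 1) y
    rw [show c + 1 + 1 = c + 2 by ring] at h2
    have h3 := (h1.pow 2).add ((((hasDerivAt_id y).mul (h2.pow 2))).div_const (c ^ 2))
    refine h3.congr_deriv ?_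
    have h4 := mul_deriv_besselSum hc y
    simp only [id, Pi.pow_apply]
    field_simp at h4 ⊢
    linear_combination (2 * besselSum (c + 1) y) * h4
  have hanti : AntitoneOn (fun y => besselSum c y ^ 2 + y * besselSum (c + 1) y ^ 2 / c ^ 2)
      (Set.Ici 0) := by
    refine antitoneOn_of_deriv_nonpos (convex_Ici 0)
      (fun y _ => (hd y).continuousAt.continuousWithinAt)
      (fun y _ => (hd y).differentiableAt.differentiableWithinAt) fun y _ => ?_
    rw [(hd y).deriv]
    refine div_nonpos_of_nonpos_of_nonneg ?_ (sq_nonneg c)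
    exact mul_nonpos_of_nonneg_of_nonpos (sq_nonneg _) (by linarith)
  have h := hanti Set.self_mem_Ici hx hx
  simp only [besselSum_zero] at h
  rw [← sq_le_one_iff_abs_le_one]
  have h2 : 0 ≤ x * besselSum (c + 1) x ^ 2 / c ^ 2 := by positivity
  norm_num at h
  linarith

/-- The derivative of `F + x/c` is `(1 - besselSum (c + 1))/c`, which is nonnegative by the bound at
parameter `c + 1`. -/
lemma one_sub_div_le_besselSum {c : ℝ} (hc : 1 / 2 ≤ c) {x : ℝ} (hx : 0 ≤ x) :
    1 - x / c ≤ besselSum c x := by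
  have hc0 : 0 < c := by linarith
  have hd (y : ℝ) : HasDerivAt (fun y => besselSum c y + y / c)
      (-besselSum (c + 1) y / c + 1 / c) y :=
    (hasDerivAt_besselSum hc y).add ((hasDerivAt_id y).div_const c)
  have hmono : MonotoneOn (fun y => besselSum c y + y / c) (Set.Ici 0) := by
    refine monotoneOn_of_deriv_nonneg (convex_Ici 0)
      (fun y _ => (hd y).continuousAt.continuousWithinAt)
      (fun y _ => (hd y).differentiableAt.differentiableWithinAt) fun y hy => ?_
    rw [interior_Ici] at hy
    rw [(hd y).deriv, ← add_div]
    have := (abs_le.1 (abs_besselSum_le_one (by linarith : 1 / 2 ≤ c + 1) (le_of_lt hy))).2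
    exact div_nonneg (by linarith) hc0.le
  have h := hmono Set.self_mem_Ici hx hx
  simp only [besselSum_zero, zero_div, add_zero] at h
  linarith

/-! ### The hypergeometric extension of the multiplier -/

/-- The coefficients of `₁F₂ (1; 2, b; -x)`. -/
def kernelCoeff (b : ℝ) (j : ℕ) : ℝ :=
  (-1) ^ j / ((j + 1).factorial * (ascPochhammer ℝ j).eval b)

lemma abs_kernelCoeff_le {b : ℝ} (hb : 1 ≤ b) (j : ℕ) : |kernelCoeff b j| ≤ 1 / j.factorial := by
  have h := one_le_ascPochhammer_eval hb j
  have hj : (0 : ℝ) < j.factorial := by positivity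
  rw [kernelCoeff, abs_div, abs_pow, abs_neg, abs_one, one_pow, abs_of_pos (by positivity)]
  refine one_div_le_one_div_of_le hj ?_
  rw [Nat.factorial_succ]
  push_cast
  have : (0 : ℝ) ≤ j := by positivity
  nlinarith [mul_nonneg this hj.le]

/-- Removing the constant term of `₀F₁` and dividing by `x` shifts its coefficients to those of the
kernel. Bounds on `besselSum` thereby become `0 ≤ H ≤ 1`. -/
lemma mul_powerSum_kernelCoeff {c : ℝ} (hc : 1 / 2 ≤ c) (x : ℝ) :
    x * powerSum (kernelCoeff (c + 1)) x = c * (1 - besselSum c x) := by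
  have hc0 : 0 < c := by linarith
  rw [besselSum, powerSum_eq_add (abs_besselCoeff_le hc)]
  have h1 : powerSum (kernelCoeff (c + 1)) x =
      -c * powerSum (fun j => besselCoeff c (j + 1)) x := by
    rw [powerSum, powerSum, ← tsum_mul_left]
    congr 1
    funext j
    have h := one_le_ascPochhammer_eval (by linarith : 1 ≤ c + 1) j
    rw [kernelCoeff, besselCoeff, ascPochhammer_eval_succ_left, pow_succ]
    field_simp
  rw [h1, besselCoeff]
  simp
  ring

lemma powerSum_kernelCoeff_nonneg {c : ℝ} (hc : 1 / 2 ≤ c) {x : ℝ} (hx : 0 < x) :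
    0 ≤ powerSum (kernelCoeff (c + 1)) x := by
  have h1 := mul_powerSum_kernelCoeff hc x
  have h2 := (abs_le.1 (abs_besselSum_le_one hc hx.le)).2
  have h3 : 0 ≤ c * (1 - besselSum c x) := mul_nonneg (by linarith) (by linarith)
  rw [← h1] at h3
  exact nonneg_of_mul_nonneg_right h3 hx

lemma powerSum_kernelCoeff_le_one {c : ℝ} (hc : 1 / 2 ≤ c) {x : ℝ} (hx : 0 < x) :
    powerSum (kernelCoeff (c + 1)) x ≤ 1 := by
  have hc0 : 0 < c := by linarith
  have h1 := mul_powerSum_kernelCoeff hc x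
  have h2 := one_sub_div_le_besselSum hc hx.le
  have h3 : c * (1 - besselSum c x) ≤ x * 1 := by
    calc c * (1 - besselSum c x) ≤ c * (x / c) := by gcongr; linarith
      _ = x * 1 := by field_simp
  rw [← h1] at h3
  exact le_of_mul_le_mul_left h3 hx

/-- The coefficients of `₂F₃ (1, a; 2, b, a + 1; -x)`. -/
def profileCoeff (a b : ℝ) (j : ℕ) : ℝ := a / (a + j) * kernelCoeff b j

/-- The function `₂F₃ (1, a; 2, b, a + 1; -x)`. -/
def profile (a b : ℝ) : ℝ → ℝ := powerSum (profileCoeff a b)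

lemma add_natCast_ne_zero {a : ℝ} (ha : -1 < a) (ha0 : a ≠ 0) (j : ℕ) : a + j ≠ 0 := by
  cases j with
  | zero => simpa using ha0
  | succ j =>
    have : (0 : ℝ) ≤ j := by positivity
    push_cast
    intro h
    linarith

lemma ascPochhammer_eval_mul_add (a : ℝ) (j : ℕ) :
    (ascPochhammer ℝ j).eval a * (a + j) = a * (ascPochhammer ℝ j).eval (a + 1) := by
  rw [← ascPochhammer_eval_succ_left, ascPochhammer_succ_eval]

lemma hypergeometric2F3_eq_profile {a b : ℝ} (ha : -1 < a) (ha0 : a ≠ 0) (hb : 1 ≤ b) (x : ℝ) :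
    hypergeometric2F3 1 a 2 b (a + 1) (-x) = profile a b x := by
  rw [hypergeometric2F3, profile, powerSum]
  congr 1
  funext j
  have h1 : (ascPochhammer ℝ j).eval 1 = j.factorial := ascPochhammer_eval_one ℝ j
  have h2 : (ascPochhammer ℝ j).eval 2 = (j + 1).factorial := by
    have := ascPochhammer_eval_succ_left 1 j
    rw [ascPochhammer_eval_one, one_mul] at this
    rw [this]
    norm_num
  have h3 := ascPochhammer_eval_mul_add a j
  have h4 := add_natCast_ne_zero ha ha0 j
  have h5 := one_le_ascPochhammer_eval hb j
  have h6 : 0 < (ascPochhammer ℝ j).eval (a + 1) := ascPochhammer_pos j (a + 1) (by linarith)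
  rw [h1, h2, profileCoeff, kernelCoeff, neg_pow]
  field_simp
  linear_combination x ^ j * h3

lemma abs_div_add_natCast_le {a : ℝ} (ha : -1 < a) (ha0 : a < 0) (j : ℕ) :
    |a / (a + j)| ≤ 1 / (1 + a) := by
  have h1 : 0 < 1 + a := by linarith
  cases j with
  | zero =>
    rw [Nat.cast_zero, add_zero, div_self ha0.ne, abs_one, le_div_iff₀ h1]
    linarith
  | succ j =>
    have hj : (0 : ℝ) ≤ j := by positivity
    push_cast
    rw [abs_div, abs_of_neg ha0, abs_of_pos (by linarith)]
    exact div_le_div₀ zero_le_one (by linarith) h1 (by linarith)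

lemma abs_profileCoeff_le {a b : ℝ} (ha : -1 < a) (ha0 : a < 0) (hb : 1 ≤ b) (j : ℕ) :
    |profileCoeff a b j| ≤ (1 / (1 + a)) / j.factorial := by
  have h1 : 0 < 1 + a := by linarith
  rw [profileCoeff, abs_mul]
  calc _ ≤ 1 / (1 + a) * (1 / j.factorial) := by
        gcongr
        · exact abs_div_add_natCast_le ha ha0 j
        · exact abs_kernelCoeff_le hb j
    _ = _ := by ring

/-- Euler's operator multiplies the `j`-th coefficient by `j + a`, cancelling the denominator of
`profileCoeff`. -/
lemma mul_deriv_profile {a b : ℝ} (ha : -1 < a) (ha0 : a < 0) (hb : 1 ≤ b) (x : ℝ) :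
    x * powerSum (derivCoeff (profileCoeff a b)) x + a * profile a b x =
      a * powerSum (kernelCoeff b) x := by
  rw [profile, mul_powerSum_derivCoeff_add (d := fun j => a * kernelCoeff b j)
    (abs_profileCoeff_le ha ha0 hb) (fun j => ?_) x, powerSum, powerSum, ← tsum_mul_left]
  · simp_rw [mul_assoc]
  · have h := add_natCast_ne_zero ha ha0.ne j
    rw [profileCoeff]
    field_simp
    ring

lemma profile_zero {a b : ℝ} (ha0 : a < 0) : profile a b 0 = 1 := by
  rw [profile, powerSum_zero, profileCoeff, kernelCoeff]
  simp [ha0.ne]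

lemma hasDerivAt_rpow_mul_profile_sub {a b : ℝ} (ha : -1 < a) (ha0 : a < 0) (hb : 1 ≤ b) (s : ℝ)
    {x : ℝ} (hx : 0 < x) : HasDerivAt (fun x => x ^ a * (profile a b x - s))
      (a * x ^ (a - 1) * (powerSum (kernelCoeff b) x - s)) x := by
  have h1 := (Real.hasDerivAt_rpow_const (p := a) (Or.inl hx.ne')).mul
    ((hasDerivAt_powerSum (abs_profileCoeff_le ha ha0 hb) x).sub_const s)
  refine h1.congr_deriv ?_
  have h2 := mul_deriv_profile ha ha0 hb x
  have h3 : x ^ a = x ^ (a - 1) * x := by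
    rw [← Real.rpow_add_one hx.ne']; ring_nf
  rw [h3]
  rw [profile] at h2
  linear_combination x ^ (a - 1) * h2

/-- The derivative is `a x^(a-1) (H - 1)`, with `a < 0` and `H ≤ 1`. It yields lower growth bounds
for the multiplier. -/
lemma monotoneOn_rpow_mul_profile_sub_one {a c : ℝ} (ha : -1 < a) (ha0 : a < 0)
    (hc : 1 / 2 ≤ c) :
    MonotoneOn (fun x => x ^ a * (profile a (c + 1) x - 1)) (Set.Ioi 0) := by
  have hd {x : ℝ} (hx : 0 < x) :=
    hasDerivAt_rpow_mul_profile_sub ha ha0 (by linarith : 1 ≤ c + 1) 1 hx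
  refine monotoneOn_of_deriv_nonneg (convex_Ioi 0)
    (fun y hy => (hd hy).continuousAt.continuousWithinAt)
    (fun y hy => (hd (interior_subset hy)).differentiableAt.differentiableWithinAt) fun y hy => ?_
  have hy0 : 0 < y := interior_subset hy
  rw [(hd hy0).deriv]
  have h := powerSum_kernelCoeff_le_one hc hy0
  exact mul_nonneg_of_nonpos_of_nonpos
    (mul_nonpos_of_nonpos_of_nonneg ha0.le (Real.rpow_nonneg hy0.le _)) (by linarith)

/-- The derivative is `a x^(a-1) H`, with `a < 0` and `H ≥ 0`. It yields upper growth bounds for the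
multiplier. -/
lemma antitoneOn_rpow_mul_profile {a c : ℝ} (ha : -1 < a) (ha0 : a < 0) (hc : 1 / 2 ≤ c) :
    AntitoneOn (fun x => x ^ a * profile a (c + 1) x) (Set.Ioi 0) := by
  have hd {x : ℝ} (hx : 0 < x) : HasDerivAt (fun x => x ^ a * profile a (c + 1) x)
      (a * x ^ (a - 1) * powerSum (kernelCoeff (c + 1)) x) x := by
    simpa only [sub_zero] using
      hasDerivAt_rpow_mul_profile_sub ha ha0 (by linarith : 1 ≤ c + 1) 0 hx
  refine antitoneOn_of_deriv_nonpos (convex_Ioi 0)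
    (fun y hy => (hd hy).continuousAt.continuousWithinAt)
    (fun y hy => (hd (interior_subset hy)).differentiableAt.differentiableWithinAt) fun y hy => ?_
  have hy0 : 0 < y := interior_subset hy
  rw [(hd hy0).deriv]
  exact mul_nonpos_of_nonpos_of_nonneg
    (mul_nonpos_of_nonpos_of_nonneg ha0.le (Real.rpow_nonneg hy0.le _))
    (powerSum_kernelCoeff_nonneg hc hy0)

/-- The linear coefficient is positive, so the profile exceeds `1` just to the right of `0`;
monotonicity of `x^a (G - 1)` propagates this to every positive `x`. -/
lemma one_lt_profile {a c : ℝ} (ha : -1 < a) (ha0 : a < 0) (hc : 1 / 2 ≤ c) {x : ℝ} (hx : 0 < x) :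
    1 < profile a (c + 1) x := by
  have hb : 1 ≤ c + 1 := by linarith
  have hd := hasDerivAt_powerSum (abs_profileCoeff_le ha ha0 hb) 0
  have hpos : 0 < powerSum (derivCoeff (profileCoeff a (c + 1))) 0 := by
    rw [powerSum_zero, derivCoeff, profileCoeff, kernelCoeff]
    simp only [Nat.cast_zero, zero_add, Nat.cast_one, one_mul, pow_one, ascPochhammer_one,
      Polynomial.eval_X]
    refine mul_pos_of_neg_of_neg (div_neg_of_neg_of_pos ha0 (by linarith)) ?_
    exact div_neg_of_neg_of_pos (by norm_num) (by positivity)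
  have h1 := (hasDerivAt_iff_tendsto_slope_zero.1 hd).mono_left
    (nhdsWithin_mono (0 : ℝ) fun y (hy : y ∈ Set.Ioi 0) => (ne_of_gt hy : y ≠ 0))
  have h2 : ∀ᶠ y in 𝓝[>] (0 : ℝ), y < x :=
    nhdsWithin_le_nhds (Iio_mem_nhds hx)
  obtain ⟨y, hy1, hyx, hy0⟩ := ((h1.eventually (lt_mem_nhds hpos)).and
    (h2.and self_mem_nhdsWithin)).exists
  have hy0' : 0 < y := hy0
  change 0 < y⁻¹ • (profile a (c + 1) (0 + y) - profile a (c + 1) 0) at hy1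
  rw [zero_add, profile_zero ha0, smul_eq_mul] at hy1
  have h3 := (mul_pos_iff_of_pos_left (inv_pos.2 hy0')).1 hy1
  have h4 := monotoneOn_rpow_mul_profile_sub_one ha ha0 hc hy0 hx hyx.le
  have h5 : 0 < y ^ a * (profile a (c + 1) y - 1) := mul_pos (Real.rpow_pos_of_pos hy0' a) h3
  have h6 := (mul_pos_iff_of_pos_left (Real.rpow_pos_of_pos hx a)).1 (h5.trans_le h4)
  linarith

/-- Every coefficient past the constant one carries a factor at most `-a/(1 + a)`, which vanishes as
`a → 0⁻`, that is, as `β` decreases to `n + 2`. -/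
lemma abs_profile_sub_one_le {a b : ℝ} (ha : -1 < a) (ha0 : a < 0) (hb : 1 ≤ b) {x : ℝ}
    (hx : 0 ≤ x) : |profile a b x - 1| ≤ -a / (1 + a) * Real.exp x := by
  have h1 : 0 < 1 + a := by linarith
  rw [profile, powerSum_eq_add (abs_profileCoeff_le ha ha0 hb)]
  have h0 : profileCoeff a b 0 = 1 := by simp [profileCoeff, kernelCoeff, ha0.ne]
  rw [h0, add_sub_cancel_left, powerSum, ← tsum_mul_left]
  have hexp : HasSum (fun j : ℕ => x ^ j / j.factorial) (Real.exp x) := by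
    rw [Real.exp_eq_exp_ℝ]
    exact NormedSpace.expSeries_div_hasSum_exp x
  have hs : Summable fun j : ℕ => x ^ (j + 1) / ((j + 1).factorial : ℝ) :=
    (summable_nat_add_iff 1).2 hexp.summable
  have hle : ∑' j : ℕ, x ^ (j + 1) / ((j + 1).factorial : ℝ) ≤ Real.exp x := by
    rw [← hexp.tsum_eq, hexp.summable.tsum_eq_zero_add]
    simp
  have h2 : ‖∑' j : ℕ, x * (profileCoeff a b (j + 1) * x ^ j)‖ ≤
      -a / (1 + a) * ∑' j : ℕ, x ^ (j + 1) / ((j + 1).factorial : ℝ) := by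
    refine tsum_of_norm_bounded (hs.hasSum.mul_left _) fun j => ?_
    have hj : (0 : ℝ) ≤ j := by positivity
    have h3 := abs_kernelCoeff_le hb (j + 1)
    have h4 : |a / (a + (j + 1 : ℕ))| ≤ -a / (1 + a) := by
      push_cast
      rw [abs_div, abs_of_neg ha0, abs_of_pos (by linarith)]
      exact div_le_div₀ (by linarith) le_rfl h1 (by linarith)
    have h5 : 0 ≤ -a / (1 + a) := div_nonneg (by linarith) h1.le
    rw [norm_mul, norm_mul, norm_pow, Real.norm_of_nonneg hx, Real.norm_eq_abs, profileCoeff,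
      abs_mul]
    calc x * (|a / (a + (j + 1 : ℕ))| * |kernelCoeff b (j + 1)| * x ^ j) ≤
        x * (-a / (1 + a) * (1 / (j + 1).factorial) * x ^ j) := by gcongr
      _ = _ := by rw [pow_succ]; ring
  exact h2.trans (mul_le_mul_of_nonneg_left hle (div_nonneg (by linarith) h1.le))

/-! ### Bounds for the multiplier -/

lemma multiplier_zero {n : ℕ} (δ β : ℝ) : multiplier δ β (0 : E n) = 0 := by
  unfold multiplier
  split_ifs <;> simp

lemma neg_multiplier_eq_mul_profile {n : ℕ} {δ β : ℝ} (h1 : (n : ℝ) + 2 < β) (h2 : β < n + 4)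
    (ν : E n) : -multiplier δ β ν = ‖ν‖ ^ 2 *
      profile (((n : ℝ) + 2 - β) / 2) ((n : ℝ) / 2 + 1) (‖ν‖ ^ 2 * (δ ^ 2 / 4)) := by
  rw [← hypergeometric2F3_eq_profile (by linarith) (by linarith)
      (by linarith [n.cast_nonneg (α := ℝ)]),
    multiplier, if_neg h1.not_gt]
  ring_nf

/-- The upper parameter `0` kills every term of the series except `j = 0`. -/
lemma neg_multiplier_add_two {n : ℕ} (δ : ℝ) (ν : E n) :
    -multiplier δ ((n : ℝ) + 2) ν = ‖ν‖ ^ 2 := by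
  have h : hypergeometric2F3 1 0 2 (((n : ℝ) + 2) / 2) (((n : ℝ) + 4 - (n + 2)) / 2)
      (-(1 / 4) * ‖ν‖ ^ 2 * δ ^ 2) = 1 := by
    rw [hypergeometric2F3, tsum_eq_single 0 fun j hj => by
      obtain ⟨i, rfl⟩ := Nat.exists_eq_succ_of_ne_zero hj
      rw [Nat.succ_eq_add_one, ascPochhammer_eval_succ_left 0]
      simp]
    simp
  rw [multiplier, if_neg (lt_irrefl _), sub_self, zero_div, h]
  ring

lemma half_le_natCast_div_two {n : ℕ} (hn : 1 ≤ n) : (1 : ℝ) / 2 ≤ (n : ℝ) / 2 := by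
  have : (1 : ℝ) ≤ n := by exact_mod_cast hn
  linarith

lemma norm_sq_le_neg_multiplier {n : ℕ} (hn : 1 ≤ n) {δ β : ℝ} (hδ : 0 < δ)
    (h1 : (n : ℝ) + 2 ≤ β) (h2 : β < n + 4) (ν : E n) : ‖ν‖ ^ 2 ≤ -multiplier δ β ν := by
  rcases h1.eq_or_lt with rfl | h1
  · exact (neg_multiplier_add_two δ ν).ge
  · rcases eq_or_ne ν 0 with rfl | hν
    · simp [multiplier_zero]
    · have hν' : 0 < ‖ν‖ := norm_pos_iff.2 hν
      rw [neg_multiplier_eq_mul_profile h1 h2]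
      exact le_mul_of_one_le_right (sq_nonneg _) (one_lt_profile (by linarith) (by linarith)
        (half_le_natCast_div_two hn) (by positivity)).le

lemma neg_multiplier_nonneg {n : ℕ} (hn : 1 ≤ n) {δ β : ℝ} (hδ : 0 < δ) (hβ : β < n + 4)
    (ν : E n) : 0 ≤ -multiplier δ β ν := by
  by_cases h : β < n + 2
  · rw [neg_multiplier_eq h]
    refine mul_nonneg (scalingConstant_pos hδ h).le (MeasureTheory.integral_nonneg fun z => ?_)
    exact div_nonneg (by simpa using Real.cos_le_one (inner ℝ ν z)) (by positivity)
  · exact (sq_nonneg _).trans (norm_sq_le_neg_multiplier hn hδ (not_lt.1 h) hβ ν)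

lemma rpow_mul_le_of_le {x₀ N a A B : ℝ} (hx₀ : 0 < x₀) (hN : 0 < N)
    (h : x₀ ^ a * A ≤ (N * x₀) ^ a * B) : N ^ (-a) * A ≤ B := by
  rw [Real.mul_rpow hN.le hx₀.le, mul_assoc, mul_left_comm] at h
  have h1 := le_of_mul_le_mul_left h (Real.rpow_pos_of_pos hx₀ a)
  rw [Real.rpow_neg hN.le, inv_mul_le_iff₀ (Real.rpow_pos_of_pos hN a)]
  exact h1

lemma le_rpow_mul_of_le {x₀ N a A B : ℝ} (hx₀ : 0 < x₀) (hN : 0 < N)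
    (h : (N * x₀) ^ a * B ≤ x₀ ^ a * A) : B ≤ N ^ (-a) * A := by
  rw [Real.mul_rpow hN.le hx₀.le, mul_comm (N ^ a), mul_assoc] at h
  have h1 := le_of_mul_le_mul_left h (Real.rpow_pos_of_pos hx₀ a)
  rw [Real.rpow_neg hN.le, le_inv_mul_iff₀ (Real.rpow_pos_of_pos hN a)]
  exact h1

/-- The multiplier is polynomially bounded on the lattice. -/
lemma exists_one_add_neg_multiplier_le {n : ℕ} (hn : 1 ≤ n) {δ β : ℝ} (hδ : 0 < δ)
    (hβ : β < n + 4) : ∃ (C : ℝ) (p : ℕ), ∀ k : Fin n → ℤ,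
      1 + -multiplier δ β (latticePoint k) ≤ C * weight k ^ p := by
  by_cases h : β ≤ n + 2
  · refine ⟨1, 1, fun k => ?_⟩
    rw [one_mul, pow_one, weight]
    rcases h.eq_or_lt with rfl | h
    · rw [neg_multiplier_add_two]
    · linarith [neg_multiplier_le hn hδ h (latticePoint k)]
  · obtain ⟨a, ha⟩ : ∃ a, a = ((n : ℝ) + 2 - β) / 2 := ⟨_, rfl⟩
    push Not at h
    have ha1 : -1 < a := by linarith
    have ha0 : a < 0 := by linarith
    have hx₀ : 0 < δ ^ 2 / 4 := by positivity
    have hc := half_le_natCast_div_two hn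
    have hG := one_lt_profile ha1 ha0 hc hx₀
    -- The base point `δ²/4` corresponds to `‖ν‖ = 1`. Since `-a < 1`, the growth `‖k‖² (‖k‖²)^(-a)`
    -- is at most `‖k‖⁴`, whence the exponent `2`.
    refine ⟨1 + profile a ((n : ℝ) / 2 + 1) (δ ^ 2 / 4), 2, fun k => ?_⟩
    rcases eq_or_ne k 0 with rfl | hk
    · rw [latticePoint_zero, multiplier_zero, weight, latticePoint_zero]
      simp
      linarith
    · have h1 := one_le_norm_latticePoint hk
      have hN : 1 ≤ ‖latticePoint k‖ ^ 2 := by nlinarith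
      have hN0 : 0 < ‖latticePoint k‖ ^ 2 := by linarith
      rw [neg_multiplier_eq_mul_profile h hβ, ← ha, weight]
      have h2 := antitoneOn_rpow_mul_profile ha1 ha0 hc hx₀
        (show ‖latticePoint k‖ ^ 2 * (δ ^ 2 / 4) ∈ Set.Ioi 0 from mul_pos hN0 hx₀)
        (le_mul_of_one_le_left hx₀.le hN)
      have h3 := le_rpow_mul_of_le hx₀ hN0 h2
      have h4 : (‖latticePoint k‖ ^ 2) ^ (-a) ≤ ‖latticePoint k‖ ^ 2 := by
        calc (‖latticePoint k‖ ^ 2) ^ (-a) ≤ (‖latticePoint k‖ ^ 2) ^ (1 : ℝ) :=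
              Real.rpow_le_rpow_of_exponent_le hN (by linarith)
          _ = _ := Real.rpow_one _
      set P := profile a ((n : ℝ) / 2 + 1) (δ ^ 2 / 4)
      have h5 := h3.trans (mul_le_mul_of_nonneg_right h4 (by linarith : 0 ≤ P))
      have h6 := mul_le_mul_of_nonneg_left h5 hN0.le
      nlinarith

/-- A lower bound for the multiplier that is uniform for `β` in `[n + 2 - ε, n + 4)`. -/
lemma exists_forall_le_neg_multiplier {n : ℕ} (hn : 1 ≤ n) {δ ε : ℝ} (hδ : 0 < δ) (hε : 0 ≤ ε) :
    ∃ c : ℝ, 0 < c ∧ c ≤ 1 ∧ ∀ β : ℝ, (n : ℝ) + 2 - ε ≤ β → β < n + 4 → ∀ k : Fin n → ℤ, k ≠ 0 →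
      c * (‖latticePoint k‖ ^ 2) ^ ((2 - ε) / 2) ≤ -multiplier δ β (latticePoint k) := by
  -- This choice makes the radius `r = κ δ / ‖ν‖` admissible in `le_neg_multiplier`: `r ≤ δ` and
  -- `‖ν‖ r ≤ 1`. The constant `43/48` below is `1 - 5/48`.
  obtain ⟨κ, hκ⟩ : ∃ κ, κ = min 1 (1 / δ) := ⟨_, rfl⟩
  have hκ0 : 0 < κ := by rw [hκ]; positivity
  have hκ1 : κ ≤ 1 := hκ ▸ min_le_left _ _
  have hκδ : κ * δ ≤ 1 := by
    rw [← le_div_iff₀ hδ, hκ]; exact min_le_right _ _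
  have hκε : κ ^ ε ≤ 1 := Real.rpow_le_one hκ0.le hκ1 hε
  have hκε0 : 0 < κ ^ ε := Real.rpow_pos_of_pos hκ0 ε
  refine ⟨43 / 48 * κ ^ ε, by positivity, by linarith, fun β h1 h2 k hk => ?_⟩
  have hν := one_le_norm_latticePoint hk
  set ν := latticePoint k
  have hν0 : 0 < ‖ν‖ := by linarith
  have hN : 1 ≤ ‖ν‖ ^ 2 := by nlinarith
  by_cases h : β < n + 2
  · have hr : 0 < κ * δ / ‖ν‖ := by positivity
    have hνr : ‖ν‖ * (κ * δ / ‖ν‖) ≤ 1 := by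
      rw [mul_div_cancel₀ _ hν0.ne']; exact hκδ
    have hrδ : κ * δ / ‖ν‖ ≤ δ := by
      rw [div_le_iff₀ hν0]; nlinarith
    have h3 := le_neg_multiplier hn hδ h ν hr hrδ hνr
    refine le_trans ?_ h3
    have h4 : κ * δ / ‖ν‖ / δ = κ / ‖ν‖ := by field_simp
    have h5 : κ ^ ε / ‖ν‖ ^ ε ≤ (κ * δ / ‖ν‖ / δ) ^ ((n : ℝ) + 2 - β) := by
      rw [h4, ← Real.div_rpow hκ0.le hν0.le]
      -- The base `κ/‖ν‖` is at most `1` and the exponent `n + 2 - β` at most `ε`; this gives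
      -- uniformity in `β`.
      refine Real.rpow_le_rpow_of_exponent_ge (by positivity) ?_ (by linarith)
      rw [div_le_one hν0]; linarith
    have h6 : 43 / 48 ≤ 1 - 5 / 48 * (‖ν‖ * (κ * δ / ‖ν‖)) ^ 2 := by
      have : (‖ν‖ * (κ * δ / ‖ν‖)) ^ 2 ≤ 1 := pow_le_one₀ (by positivity) hνr
      linarith
    have h7 : (‖ν‖ ^ 2) ^ ((2 - ε) / 2) = ‖ν‖ ^ 2 / ‖ν‖ ^ ε := by
      rw [← Real.rpow_natCast, ← Real.rpow_mul hν0.le, ← Real.rpow_sub hν0]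
      congr 1
      push_cast
      ring
    rw [h7]
    calc 43 / 48 * κ ^ ε * (‖ν‖ ^ 2 / ‖ν‖ ^ ε) = ‖ν‖ ^ 2 * (κ ^ ε / ‖ν‖ ^ ε) * (43 / 48) := by
          ring
      _ ≤ _ := by gcongr
  · refine le_trans ?_ (norm_sq_le_neg_multiplier hn hδ (not_lt.1 h) h2 ν)
    have h3 : (‖ν‖ ^ 2) ^ ((2 - ε) / 2) ≤ ‖ν‖ ^ 2 := by
      calc (‖ν‖ ^ 2) ^ ((2 - ε) / 2) ≤ (‖ν‖ ^ 2) ^ (1 : ℝ) :=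
            Real.rpow_le_rpow_of_exponent_le hN (by linarith)
        _ = _ := Real.rpow_one _
    exact (mul_le_of_le_one_left (by positivity) (by linarith)).trans h3

/-- Up to `n + 2` this is the uniform bound with `ε = n + 2 - β`. Above, comparing `x^a (G - 1)` at
`δ²/4` and `‖k‖² δ²/4` produces the extra power `(‖k‖²)^(-a)`. -/
lemma exists_le_neg_multiplier {n : ℕ} (hn : 1 ≤ n) {δ β : ℝ} (hδ : 0 < δ)
    (h2 : β < n + 4) : ∃ c : ℝ, 0 < c ∧ ∀ k : Fin n → ℤ, k ≠ 0 →
      c * (‖latticePoint k‖ ^ 2) ^ ((β - (n : ℝ)) / 2) ≤ -multiplier δ β (latticePoint k) := by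
  by_cases h : β ≤ n + 2
  · obtain ⟨c, hc, -, hcβ⟩ := exists_forall_le_neg_multiplier hn hδ
      (by linarith : 0 ≤ (n : ℝ) + 2 - β)
    refine ⟨c, hc, fun k hk => ?_⟩
    have := hcβ β (by linarith) h2 k hk
    rwa [show (2 - ((n : ℝ) + 2 - β)) / 2 = (β - n) / 2 by ring] at this
  · obtain ⟨a, ha⟩ : ∃ a, a = ((n : ℝ) + 2 - β) / 2 := ⟨_, rfl⟩
    push Not at h
    have ha1 : -1 < a := by linarith
    have ha0 : a < 0 := by linarith
    have hx₀ : 0 < δ ^ 2 / 4 := by positivity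
    have hc := half_le_natCast_div_two hn
    refine ⟨profile a ((n : ℝ) / 2 + 1) (δ ^ 2 / 4) - 1,
      sub_pos.2 (one_lt_profile ha1 ha0 hc hx₀), fun k hk => ?_⟩
    have h1 := one_le_norm_latticePoint hk
    have hN : 1 ≤ ‖latticePoint k‖ ^ 2 := by nlinarith
    have hN0 : 0 < ‖latticePoint k‖ ^ 2 := by linarith
    rw [neg_multiplier_eq_mul_profile h h2, ← ha]
    have h3 := rpow_mul_le_of_le hx₀ hN0 (monotoneOn_rpow_mul_profile_sub_one ha1 ha0 hc hx₀
      (show ‖latticePoint k‖ ^ 2 * (δ ^ 2 / 4) ∈ Set.Ioi 0 from mul_pos hN0 hx₀)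
      (le_mul_of_one_le_left hx₀.le hN))
    have h4 : (‖latticePoint k‖ ^ 2) ^ ((β - (n : ℝ)) / 2) =
        ‖latticePoint k‖ ^ 2 * (‖latticePoint k‖ ^ 2) ^ (-a) := by
      rw [mul_comm, ← Real.rpow_add_one hN0.ne']
      congr 1
      rw [ha]
      ring
    rw [h4, mul_comm, mul_assoc]
    exact mul_le_mul_of_nonneg_left (by linarith) hN0.le

/-- The nonlocal multiplier converges to that of the Laplacian as `β → n + 2`. -/
lemma tendsto_neg_multiplier {n : ℕ} (hn : 1 ≤ n) {δ : ℝ} (hδ : 0 < δ) (ν : E n) :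
    Tendsto (fun β => -multiplier δ β ν) (𝓝 ((n : ℝ) + 2)) (𝓝 (‖ν‖ ^ 2)) := by
  have h4 : ∀ᶠ β in 𝓝 ((n : ℝ) + 2), β < (n : ℝ) + 4 := Iio_mem_nhds (by linarith)
  have h3 : ∀ᶠ β in 𝓝 ((n : ℝ) + 2), (n : ℝ) + 1 < β := Ioi_mem_nhds (by linarith)
  refine tendsto_order.2 ⟨fun y hy => ?_, fun y hy => ?_⟩
  -- The radius is fixed before `β` moves, small enough that the quartic loss stays below the gap to
  -- `y`; the factor `(r/δ)^(n+2-β)` then tends to `1`.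
  · have hr : ∃ r : ℝ, 0 < r ∧ r ≤ δ ∧ ‖ν‖ * r ≤ 1 ∧
        y < ‖ν‖ ^ 2 * (1 - 5 / 48 * (‖ν‖ * r) ^ 2) := by
      have e1 : ∀ᶠ r in 𝓝[>] (0 : ℝ), r < δ := nhdsWithin_le_nhds (Iio_mem_nhds hδ)
      have e2 : Tendsto (fun r : ℝ => ‖ν‖ * r) (𝓝[>] 0) (𝓝 0) := by
        have : Tendsto (fun r : ℝ => ‖ν‖ * r) (𝓝 0) (𝓝 (‖ν‖ * 0)) := by
          exact (continuous_const.mul continuous_id).tendsto 0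
        rw [mul_zero] at this
        exact this.mono_left nhdsWithin_le_nhds
      have e3 : Tendsto (fun r : ℝ => ‖ν‖ ^ 2 * (1 - 5 / 48 * (‖ν‖ * r) ^ 2)) (𝓝[>] 0)
          (𝓝 (‖ν‖ ^ 2)) := by
        have := (((e2.pow 2).const_mul (5 / 48)).const_sub 1).const_mul (‖ν‖ ^ 2)
        simpa using this
      obtain ⟨r, h1, h2, h3, h4⟩ := (e1.and ((e2.eventually (gt_mem_nhds zero_lt_one)).and
        ((e3.eventually (lt_mem_nhds hy)).and self_mem_nhdsWithin))).exists
      exact ⟨r, h4, h1.le, h2.le, h3⟩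
    obtain ⟨r, hr0, hrδ, hνr, hyr⟩ := hr
    have hlim : Tendsto (fun β : ℝ => ‖ν‖ ^ 2 * (r / δ) ^ ((n : ℝ) + 2 - β) *
        (1 - 5 / 48 * (‖ν‖ * r) ^ 2)) (𝓝 ((n : ℝ) + 2))
        (𝓝 (‖ν‖ ^ 2 * (1 - 5 / 48 * (‖ν‖ * r) ^ 2))) := by
      have hrd : 0 < r / δ := by positivity
      have e1 : Continuous fun β : ℝ => ‖ν‖ ^ 2 * (r / δ) ^ ((n : ℝ) + 2 - β) *
          (1 - 5 / 48 * (‖ν‖ * r) ^ 2) := by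
        have : Continuous fun β : ℝ => (r / δ) ^ ((n : ℝ) + 2 - β) :=
          (Real.continuous_const_rpow hrd.ne').comp (by fun_prop)
        fun_prop
      have e2 := e1.tendsto ((n : ℝ) + 2)
      simpa using e2
    filter_upwards [h4, hlim.eventually (lt_mem_nhds hyr)] with β hβ4 hβ
    by_cases h : β < n + 2
    · exact hβ.trans_le (le_neg_multiplier hn hδ h ν hr0 hrδ hνr)
    · exact hy.trans_le (norm_sq_le_neg_multiplier hn hδ (not_lt.1 h) hβ4 ν)
  · have hlim : Tendsto (fun β : ℝ => ‖ν‖ ^ 2 * (1 + -(((n : ℝ) + 2 - β) / 2) /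
        (1 + ((n : ℝ) + 2 - β) / 2) * Real.exp (‖ν‖ ^ 2 * (δ ^ 2 / 4)))) (𝓝 ((n : ℝ) + 2))
        (𝓝 (‖ν‖ ^ 2)) := by
      have e1 : ContinuousAt (fun β : ℝ => ‖ν‖ ^ 2 * (1 + -(((n : ℝ) + 2 - β) / 2) /
        (1 + ((n : ℝ) + 2 - β) / 2) * Real.exp (‖ν‖ ^ 2 * (δ ^ 2 / 4)))) ((n : ℝ) + 2) := by
        refine ContinuousAt.mul (by fun_prop) (ContinuousAt.add (by fun_prop)
          (ContinuousAt.mul (ContinuousAt.div (by fun_prop) (by fun_prop) (by simp))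
            (by fun_prop)))
      simpa using e1.tendsto
    filter_upwards [h4, h3, hlim.eventually (gt_mem_nhds hy)] with β hβ4 hβ3 hβ
    rcases lt_trichotomy β (n + 2) with h | h | h
    · exact (neg_multiplier_le hn hδ h ν).trans_lt hy
    · rw [h, neg_multiplier_add_two]; exact hy
    · refine lt_of_le_of_lt ?_ hβ
      rw [neg_multiplier_eq_mul_profile h hβ4]
      refine mul_le_mul_of_nonneg_left ?_ (sq_nonneg _)
      have := (abs_le.1 (abs_profile_sub_one_le (a := ((n : ℝ) + 2 - β) / 2)
        (b := (n : ℝ) / 2 + 1) (by linarith) (by linarith)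
        (by linarith [n.cast_nonneg (α := ℝ)]) (x := ‖ν‖ ^ 2 * (δ ^ 2 / 4)) (by positivity))).2
      linarith

/-! ### The two wave equations -/

lemma fourierCoefficient_of_isNonlocalLaplacian {n : ℕ} {δ β : ℝ} (T S : PeriodicDistribution n)
    (h : IsNonlocalLaplacian δ β T S) (k : Fin n → ℤ) : fourierCoefficient S k =
      -((-multiplier δ β (latticePoint k) : ℝ) : ℂ) * fourierCoefficient T k := by
  rw [h k]
  push_cast
  ring

lemma fourierCoefficient_eq_neg_mul_of_isLaplacian {n : ℕ} (T S : PeriodicDistribution n)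
    (h : IsLaplacian T S) (k : Fin n → ℤ) : fourierCoefficient S k =
      -((‖latticePoint k‖ ^ 2 : ℝ) : ℂ) * fourierCoefficient T k := by
  rw [fourierCoefficient_of_isLaplacian h]
  push_cast
  ring

lemma exists_isNonlocalLaplacian {n : ℕ} (hn : 1 ≤ n) {δ β : ℝ} (hδ : 0 < δ) (hβ : β < n + 4)
    (T : PeriodicDistribution n) (q : ℝ) (hT : MemH q T) : ∃ S, IsNonlocalLaplacian δ β T S := by
  obtain ⟨C, p, hC⟩ := exists_one_add_neg_multiplier_le hn hδ hβ
  obtain ⟨D, r, hD, hTk⟩ := hT.exists_norm_fourierCoefficient_le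
  refine exists_fourierCoefficient_eq (C := C * D) (p := p + r) fun k => ?_
  have h0 := neg_multiplier_nonneg hn hδ hβ (latticePoint k)
  have h1 := hC k
  rw [norm_mul, Complex.norm_real, ← norm_neg, Real.norm_of_nonneg h0]
  calc -multiplier δ β (latticePoint k) * ‖fourierCoefficient T k‖
      ≤ (C * weight k ^ p) * (D * weight k ^ r) :=
        mul_le_mul (by linarith) (hTk k) (norm_nonneg _) (by linarith)
    _ = _ := by rw [pow_add]; ring

theorem exists_isClassicalWaveSolution {n : ℕ} {s₁ s₂ : ℝ} {f g : PeriodicDistribution n}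
    (hf : MemH s₁ f) (hg : MemH s₂ g) : ∃ U, IsClassicalWaveSolution f g U :=
  exists_isWaveSolution (μ := fun k => ‖latticePoint k‖ ^ 2) (C := 1) (p := 1)
    (fun k => sq_nonneg _) (fun k => by rw [one_mul, pow_one, weight])
    (fun T _ _ => ⟨distLaplacian T, isLaplacian_distLaplacian T,
      fourierCoefficient_eq_neg_mul_of_isLaplacian _ _ (isLaplacian_distLaplacian T)⟩) hf hg

theorem exists_isNonlocalWaveSolution {n : ℕ} (hn : 1 ≤ n) {δ β : ℝ} (hδ : 0 < δ)
    (hβ : β < n + 4) {s₁ s₂ : ℝ} {f g : PeriodicDistribution n}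
    (hf : MemH s₁ f) (hg : MemH s₂ g) : ∃ U, IsNonlocalWaveSolution δ β f g U := by
  obtain ⟨C, p, hC⟩ := exists_one_add_neg_multiplier_le hn hδ hβ
  refine exists_isWaveSolution (fun k => neg_multiplier_nonneg hn hδ hβ (latticePoint k)) hC
    (fun T q hT => ?_) hf hg
  obtain ⟨S, hS⟩ := exists_isNonlocalLaplacian hn hδ hβ T q hT
  exact ⟨S, hS, fourierCoefficient_of_isNonlocalLaplacian T S hS⟩

lemma IsClassicalWaveSolution.fourierCoefficient_eq {n : ℕ} {f g : PeriodicDistribution n}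
    {U : ℝ → PeriodicDistribution n} (hU : IsClassicalWaveSolution f g U) {t : ℝ} (ht : 0 ≤ t)
    (k : Fin n → ℤ) : fourierCoefficient (U t) k =
      waveSol (‖latticePoint k‖ ^ 2) (fourierCoefficient f k) (fourierCoefficient g k) t :=
  IsWaveSolution.fourierCoefficient_eq (μ := fun k => ‖latticePoint k‖ ^ 2) (fun _ => sq_nonneg _)
    fourierCoefficient_eq_neg_mul_of_isLaplacian hU ht k

lemma IsNonlocalWaveSolution.fourierCoefficient_eq {n : ℕ} (hn : 1 ≤ n) {δ β : ℝ} (hδ : 0 < δ)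
    (hβ : β < n + 4) {f g : PeriodicDistribution n} {U : ℝ → PeriodicDistribution n}
    (hU : IsNonlocalWaveSolution δ β f g U) {t : ℝ} (ht : 0 ≤ t) (k : Fin n → ℤ) :
    fourierCoefficient (U t) k = waveSol (-multiplier δ β (latticePoint k))
      (fourierCoefficient f k) (fourierCoefficient g k) t :=
  IsWaveSolution.fourierCoefficient_eq (μ := fun k => -multiplier δ β (latticePoint k))
    (fun _ => neg_multiplier_nonneg hn hδ hβ _) fourierCoefficient_of_isNonlocalLaplacian hU ht k

theorem IsClassicalWaveSolution.memH {n : ℕ} {s₁ s₂ : ℝ} {f g : PeriodicDistribution n}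
    (hf : MemH s₁ f) (hg : MemH s₂ g) {U : ℝ → PeriodicDistribution n}
    (hU : IsClassicalWaveSolution f g U) {t : ℝ} (ht : 0 ≤ t) : MemH (min s₁ (s₂ + 1)) (U t) :=
  memH_of_waveSin_sq_le hf hg (hU.fourierCoefficient_eq ht)
    (waveSin_sq_le (fun _ => sq_nonneg _) one_pos (fun k _ => by simp) zero_le_one t)

theorem IsNonlocalWaveSolution.memH {n : ℕ} (hn : 1 ≤ n) {δ β : ℝ} (hδ : 0 < δ)
    (hβ : β < n + 4) {s₁ s₂ : ℝ} {f g : PeriodicDistribution n}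
    (hf : MemH s₁ f) (hg : MemH s₂ g) {U : ℝ → PeriodicDistribution n}
    (hU : IsNonlocalWaveSolution δ β f g U) {t : ℝ} (ht : 0 ≤ t) :
    MemH (min s₁ (s₂ + max 0 ((β - (n : ℝ)) / 2))) (U t) := by
  -- For `β ≤ n` nothing is gained and `|waveSin| ≤ |t|` suffices.
  rcases le_total ((β - (n : ℝ)) / 2) 0 with h | h
  · rw [max_eq_left h]
    refine memH_of_waveSin_sq_le (K := t ^ 2) hf hg (hU.fourierCoefficient_eq hn hδ hβ ht)
      fun k => ?_
    rw [neg_zero, Real.rpow_zero, mul_one]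
    exact sq_le_sq.2 (abs_waveSin_le (neg_multiplier_nonneg hn hδ hβ _) t)
  · rw [max_eq_right h]
    obtain ⟨c, hc, hck⟩ := exists_le_neg_multiplier hn hδ hβ
    exact memH_of_waveSin_sq_le hf hg (hU.fourierCoefficient_eq hn hδ hβ ht)
      (waveSin_sq_le (fun _ => neg_multiplier_nonneg hn hδ hβ _) hc hck h t)

theorem tendstoH_nonlocal_classical {n : ℕ} (hn : 1 ≤ n) {δ : ℝ} (hδ : 0 < δ) {s₁ s₂ : ℝ}
    {f g : PeriodicDistribution n} (hf : MemH s₁ f) (hg : MemH s₂ g)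
    {U₀ : ℝ → PeriodicDistribution n} {U : ℝ → ℝ → PeriodicDistribution n}
    (hU₀ : IsClassicalWaveSolution f g U₀)
    (hU : ∀ β : ℝ, β < n + 4 → IsNonlocalWaveSolution δ β f g (U β)) {t : ℝ} (ht : 0 ≤ t)
    {ε : ℝ} (hε : 0 < ε) (hε2 : ε < 2) :
    TendstoH (min s₁ (s₂ + (2 - ε) / 2)) (fun β => U β t) (𝓝 ((n : ℝ) + 2)) (U₀ t) := by
  obtain ⟨c, hc, hc1, hck⟩ := exists_forall_le_neg_multiplier hn hδ hε.le
  have h4 : ∀ᶠ β in 𝓝 ((n : ℝ) + 2), β < (n : ℝ) + 4 := Iio_mem_nhds (by linarith)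
  have h3 : ∀ᶠ β in 𝓝 ((n : ℝ) + 2), (n : ℝ) + 2 - ε < β := Ioi_mem_nhds (by linarith)
  have hσ : 0 ≤ (2 - ε) / 2 := by linarith
  refine tendstoH_of_waveSin_sq_le (K := t ^ 2 + 2 ^ ((2 - ε) / 2) / c)
    (m := fun β k => -multiplier δ β (latticePoint k)) hf hg (hU₀.fourierCoefficient_eq ht) ?_
    (waveSin_sq_le (fun _ => sq_nonneg _) hc (fun k hk => ?_) hσ t) ?_ (fun k hk => ?_) ?_
    fun k => tendsto_neg_multiplier hn hδ _
  · filter_upwards [h4] with β hβ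
    exact (hU β hβ).fourierCoefficient_eq hn hδ hβ ht
  -- The classical multiplier is the nonlocal one at `β = n + 2`, so the same constant `c` serves
  -- for the limit.
  · rw [← neg_multiplier_add_two δ]
    simpa [neg_multiplier_add_two] using hck (n + 2) (by linarith) (by linarith) k hk
  · filter_upwards [h3, h4] with β hβ3 hβ
    exact waveSin_sq_le (fun _ => neg_multiplier_nonneg hn hδ hβ _) hc (hck β hβ3.le hβ) hσ t
  · have := one_le_norm_latticePoint hk
    positivity
  · refine Eventually.of_forall fun β => ?_
    simp [latticePoint_zero, multiplier_zero]

end NonlocalWave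

end

theorem mainTheorem5 (n : ℕ) (hn : 1 ≤ n) (δ : ℝ) (hδ : 0 < δ) (s₁ s₂ : ℝ)
    (f g : NonlocalWave.PeriodicDistribution n)
    (hf : NonlocalWave.MemH s₁ f) (hg : NonlocalWave.MemH s₂ g) :
    (∃ U₀ : ℝ → NonlocalWave.PeriodicDistribution n,
      NonlocalWave.IsClassicalWaveSolution f g U₀) ∧
    (∀ β : ℝ, β < (n : ℝ) + 4 → ∃ U : ℝ → NonlocalWave.PeriodicDistribution n,
      NonlocalWave.IsNonlocalWaveSolution δ β f g U) ∧
    ∀ (U₀ : ℝ → NonlocalWave.PeriodicDistribution n)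
      (U : ℝ → ℝ → NonlocalWave.PeriodicDistribution n),
      NonlocalWave.IsClassicalWaveSolution f g U₀ →
      (∀ β : ℝ, β < (n : ℝ) + 4 → NonlocalWave.IsNonlocalWaveSolution δ β f g (U β)) →
      (∀ t : ℝ, 0 ≤ t → NonlocalWave.MemH (min s₁ (s₂ + 1)) (U₀ t)) ∧
      (∀ β : ℝ, β < (n : ℝ) + 4 → ∀ t : ℝ, 0 ≤ t →
        NonlocalWave.MemH (min s₁ (s₂ + max 0 ((β - (n : ℝ)) / 2))) (U β t)) ∧
      ∀ t : ℝ, 0 ≤ t → ∀ ε : ℝ, 0 < ε → ε < 2 → ε < (n : ℝ) / 2 →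
        NonlocalWave.TendstoH (min s₁ (s₂ + (2 - ε) / 2)) (fun β : ℝ => U β t)
          (𝓝 ((n : ℝ) + 2)) (U₀ t) := by
  exact ⟨NonlocalWave.exists_isClassicalWaveSolution hf hg,
    fun β hβ => NonlocalWave.exists_isNonlocalWaveSolution hn hδ hβ hf hg,
    fun U₀ U hU₀ hU => ⟨fun t ht => hU₀.memH hf hg ht,
      fun β hβ t ht => (hU β hβ).memH hn hδ hβ hf hg ht,
      fun t ht ε hε hε2 _ =>
        NonlocalWave.tendstoH_nonlocal_classical hn hδ hf hg hU₀ hU ht hε hε2⟩⟩
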